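/- Let $Y_0,Y_1,Y_2,\dots$ (transmission delays) be i.i.d. random variables with $\Pr(Y_j\in[B_L,B_U])=1$, where $B_L>0$, let $M\in(0,\infty)$ be the maximal waiting period, and let $g:[0,\infty)\to[0,\infty)$ (age penalty) be continuous and nondecreasing. A causal update policy $\pi=(Z_0,Z_1,\dots)$ consists of random waiting periods $Z_j\in[0,M]$, possibly randomized, such that for every $j$ the vector $(Y_0,Z_0,\dots,Y_j,Z_j)$ is independent of $(Y_{j+1},Y_{j+2},\dots)$; let $\Pi$ be the set of these policies. Under $\pi$, update $0$ is delivered at time $D_0=0$, update $j+1$ is requested at $R_{j+1}=D_j+Z_j$, update $j$ is delivered at $D_j=R_j+Y_j$ (so $R_0=-Y_0$), and the age of information at time $t\ge 0$ is $\Delta(t)=t-\max\{R_j: D_j\le t\}$. For $f_{\max}\in(0,\infty]$, the power constraint on $\pi$ is $$\liminf_{n\to\infty}\frac1n\,E\Big[\sum_{j=0}^{n-1}(Y_j+Z_j)\Big]\ \ge\ \frac1{f_{\max}}$$ (no constraint if $f_{\max}=\infty$). Let the queries be deterministic and periodic, $Q_k=kT$ for $k=1,2,\dots$, with period $T>0$.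 Let $$\bar h_{opt}=\inf_{\pi}\ \limsup_{n\to\infty}\frac{E\big[\sum_{k=1}^n g(\Delta(Q_k))\big]}{n},\qquad \bar g_{opt}=\inf_{\pi}\ \limsup_{n\to\infty}\frac{E\big[\int_0^{D_n} g(\Delta(t))\,dt\big]}{E[D_n]},$$ where both infima are over the policies $\pi\in\Pi$ that satisfy the power constraint with the same $f_{\max}$, and the infimum over the empty set is $+\infty$. Then $\bar h_{opt}\le\bar g_{opt}$ for every period $T>0$ and every $f_{\max}$. -/

import Mathlib

open MeasureTheory ProbabilityTheory Filter
open scoped NNReal ENNReal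

namespace PullOrWait

noncomputable section

variable {Ω : Type*}

/-- Delivery times `D j` of the updates. Update `0` is delivered at time `0`; after the delivery of
update `j` one waits for `Z j`, then update `j + 1` is requested and takes `Y (j + 1)` to arrive. -/
def deliveryTime (Y Z : ℕ → Ω → ℝ) : ℕ → Ω → ℝ
  | 0, _ => 0
  | j + 1, ω => deliveryTime Y Z j ω + Z j ω + Y (j + 1) ω

/-- Request (and generation) times `R j`, given by `D j = R j + Y j`. -/
def requestTime (Y Z : ℕ → Ω → ℝ) (j : ℕ) (ω : Ω) : ℝ :=
  deliveryTime Y Z j ω - Y j ω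

/-- The waiting period `Z j` separates the delivery of update `j` from the next request. -/
theorem requestTime_succ (Y Z : ℕ → Ω → ℝ) (j : ℕ) (ω : Ω) :
    requestTime Y Z (j + 1) ω = deliveryTime Y Z j ω + Z j ω := by
  simp [requestTime, deliveryTime]

/-- `U(t) = max {R j : D j ≤ t}`, the generation time of the freshest update received by time `t`.
-/
def lastGeneration (Y Z : ℕ → Ω → ℝ) (t : ℝ) (ω : Ω) : ℝ :=
  sSup {r : ℝ | ∃ j : ℕ, deliveryTime Y Z j ω ≤ t ∧ r = requestTime Y Z j ω}

/-- The age of information `Δ(t) = t - U(t)`. -/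
def age (Y Z : ℕ → Ω → ℝ) (t : ℝ) (ω : Ω) : ℝ :=
  t - lastGeneration Y Z t ω

/-- The age penalty `g(Δ(t))`, as an extended nonnegative number. -/
def agePenalty (g : ℝ≥0 → ℝ≥0) (Y Z : ℕ → Ω → ℝ) (t : ℝ) (ω : Ω) : ℝ≥0∞ :=
  (g (Real.toNNReal (age Y Z t ω)) : ℝ≥0∞)

/-- A causal update policy (possibly randomized or history dependent) for the delays `Y`: waiting
periods in `[0, M]` such that, for every `j`, everything decided and observed up to the choice of
`Z j` is independent of the delays of the updates that are still to be requested. -/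
structure CausalPolicy [MeasurableSpace Ω] (P : Measure Ω) (Y : ℕ → Ω → ℝ) (M : ℝ) where
  /-- the waiting periods -/
  wait : ℕ → Ω → ℝ
  measurable_wait : ∀ j, Measurable (wait j)
  wait_mem : ∀ j ω, wait j ω ∈ Set.Icc 0 M
  causal : ∀ j : ℕ, IndepFun
    (fun ω (i : Fin (j + 1)) => (Y i ω, wait i ω))
    (fun ω (i : ℕ) => Y (j + 1 + i) ω) P

variable [MeasurableSpace Ω]

/-- The power constraint with maximal average update frequency `fmax`: the long-run expected time
per update is at least `1 / fmax`. The value `fmax = ∞` means that there is no constraint. -/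
def MeetsPower (P : Measure Ω) (Y Z : ℕ → Ω → ℝ) (fmax : ℝ≥0∞) : Prop :=
  fmax⁻¹ ≤ liminf (fun n : ℕ =>
    (∫⁻ ω, ENNReal.ofReal (∑ j ∈ Finset.range n, (Y j ω + Z j ω)) ∂P) / (n : ℝ≥0∞)) atTop

/-- The query average age penalty `limsup E[∑_{k=1}^n g(Δ(Q k))] / n` for query instants
`Q 1, Q 2, …`. -/
def queryAverage (P : Measure Ω) (g : ℝ≥0 → ℝ≥0) (Y Z : ℕ → Ω → ℝ) (Q : ℕ → ℝ) : ℝ≥0∞ :=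
  limsup (fun n : ℕ =>
    (∫⁻ ω, ∑ k ∈ Finset.Icc 1 n, agePenalty g Y Z (Q k) ω ∂P) / (n : ℝ≥0∞)) atTop

/-- The time average age penalty `limsup E[∫_0^{D n} g(Δ(t)) dt] / E[D n]`. -/
def timeAverage (P : Measure Ω) (g : ℝ≥0 → ℝ≥0) (Y Z : ℕ → Ω → ℝ) : ℝ≥0∞ :=
  limsup (fun n : ℕ =>
    (∫⁻ ω, (∫⁻ t in Set.Icc 0 (deliveryTime Y Z n ω), agePenalty g Y Z t ω) ∂P) /
      (∫⁻ ω, ENNReal.ofReal (deliveryTime Y Z n ω) ∂P)) atTop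

/-- Optimal value of the Pull-or-Wait problem with deterministic query instants `Q 1, Q 2, …`:
the least query average age penalty over the causal policies meeting the power constraint. -/
def powOpt (P : Measure Ω) (g : ℝ≥0 → ℝ≥0) (Y : ℕ → Ω → ℝ) (M : ℝ) (fmax : ℝ≥0∞)
    (Q : ℕ → ℝ) : ℝ≥0∞ :=
  ⨅ (π : CausalPolicy P Y M) (_ : MeetsPower P Y π.wait fmax), queryAverage P g Y π.wait Q

/-- Optimal value of the Update-or-Wait problem: the least time average age penalty over the causal
policies meeting the power constraint. -/
def uowOpt (P : Measure Ω) (g : ℝ≥0 → ℝ≥0) (Y : ℕ → Ω → ℝ) (M : ℝ) (fmax : ℝ≥0∞) : ℝ≥0∞ :=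
  ⨅ (π : CausalPolicy P Y M) (_ : MeetsPower P Y π.wait fmax), timeAverage P g Y π.wait

end

end PullOrWait

/-! Both optimal values are compared with the ratio `meanCost` / `meanCycle` at a level `x`: the
mean penalty per unit time when one always waits until the age reaches `x`, with the wait clipped to
`[0, M]` (water-filling).

Every policy is at least as costly as some level. The cost of a cycle is convex in its waiting
period, because the penalty is nondecreasing. Linearized at the water-filling wait, its slope is the
penalty at `x + Y (j + 1)`; by causality this is independent of the wait, and its mean does not
depend on `j` (`CausalPolicy.integral_cost_ge`). If `x` is chosen so that water-filling has the same
mean wait as the policy over `n` updates, the linear terms cancel in the sum. These levels stay in a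
compact interval, and a limit point inherits both the power constraint and the cost bound
(`CausalPolicy.exists_level_le_timeAverage`).

Conversely, each level can be matched at the queries. Plain water-filling may be badly in phase with
the queries, but if its deliveries are delayed by a uniformly distributed time over one period, the
queries see at most the time integral of the penalty divided by `T`. So some fixed delay does at
least as well (`exists_shift`). A good delay depends on the stretch of updates considered, so the
updates are cut into growing blocks, each with its own delay, and `m` padding updates at the start
of a block move from one delay to the next. The first `r` blocks contain `m * r ^ 2` updates but
only `r * m` padding ones, so padding affects neither average in the limit. The law of large numbers
in mean controls how many blocks cover the first `n` queries (`IsDelay.exists_policy`). -/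

namespace PullOrWait

noncomputable section

/-- The age penalty as a real function of a real age. -/
def penalty (g : ℝ≥0 → ℝ≥0) (t : ℝ) : ℝ := g t.toNNReal

/-! ### Cost of one cycle, and its convexity in the waiting period -/

section Penalty

variable {g : ℝ≥0 → ℝ≥0}

theorem penalty_nonneg (g : ℝ≥0 → ℝ≥0) (t : ℝ) : 0 ≤ penalty g t := NNReal.coe_nonneg _

theorem penalty_mono (hg : Monotone g) : Monotone (penalty g) :=
  fun _ _ h => NNReal.coe_le_coe.2 (hg (Real.toNNReal_mono h))

theorem continuous_penalty (hg : Continuous g) : Continuous (penalty g) :=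
  NNReal.continuous_coe.comp (hg.comp continuous_real_toNNReal)

theorem agePenalty_eq_ofReal {Ω : Type*} (g : ℝ≥0 → ℝ≥0) (Y Z : ℕ → Ω → ℝ) (t : ℝ) (ω : Ω) :
    agePenalty g Y Z t ω = ENNReal.ofReal (penalty g (age Y Z t ω)) :=
  (ENNReal.ofReal_coe_nnreal).symm

/-- The penalty accumulated between two deliveries, when the first update took `y`, the waiting
period is `z` and the second update takes `y'`. -/
def cycleCost (g : ℝ≥0 → ℝ≥0) (y z y' : ℝ) : ℝ := ∫ t in y..(y + z + y'), penalty g t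

theorem continuous_cycleCost (hg : Continuous g) :
    Continuous fun p : ℝ × ℝ × ℝ => cycleCost g p.1 p.2.1 p.2.2 := by
  have hi : ∀ a b : ℝ, IntervalIntegrable (penalty g) volume a b :=
    fun a b => (continuous_penalty hg).intervalIntegrable a b
  have h : (fun p : ℝ × ℝ × ℝ => cycleCost g p.1 p.2.1 p.2.2) = fun p : ℝ × ℝ × ℝ =>
      (∫ t in (0 : ℝ)..(p.1 + p.2.1 + p.2.2), penalty g t) - ∫ t in (0 : ℝ)..p.1, penalty g t := by
    funext p
    exact (intervalIntegral.integral_interval_sub_left (hi _ _) (hi _ _)).symm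
  rw [h]
  have hc := intervalIntegral.continuous_primitive hi 0
  exact (hc.comp (by fun_prop)).sub (hc.comp (by fun_prop))

theorem measurable_cycleCost (hg : Continuous g) {Ω : Type*} [MeasurableSpace Ω] {u v w : Ω → ℝ}
    (hu : Measurable u) (hv : Measurable v) (hw : Measurable w) :
    Measurable fun ω => cycleCost g (u ω) (v ω) (w ω) :=
  (continuous_cycleCost hg).measurable.comp (hu.prodMk (hv.prodMk hw))

theorem cycleCost_nonneg {y z y' : ℝ} (h : 0 ≤ z + y') : 0 ≤ cycleCost g y z y' :=
  intervalIntegral.integral_nonneg (by linarith) fun _ _ => penalty_nonneg _ _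

theorem cycleCost_le (hgc : Continuous g) (hgm : Monotone g) {y z y' A C : ℝ} (h : 0 ≤ z + y')
    (hA : y + z + y' ≤ A) (hC : z + y' ≤ C) : cycleCost g y z y' ≤ penalty g A * C := by
  have h1 : cycleCost g y z y' ≤ ∫ _t in y..(y + z + y'), penalty g A := by
    refine intervalIntegral.integral_mono_on (by linarith)
      ((continuous_penalty hgc).intervalIntegrable _ _) (by simp) fun t ht => ?_
    exact penalty_mono hgm (ht.2.trans hA)
  rw [intervalIntegral.integral_const, smul_eq_mul] at h1
  nlinarith [penalty_nonneg g A]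

/-- The water-filling waiting period: wait until the age reaches the level `x`, but at most `M`. -/
def fill (M x y : ℝ) : ℝ := max 0 (min M (x - y))

theorem fill_mem {M : ℝ} (hM : 0 ≤ M) (x y : ℝ) : fill M x y ∈ Set.Icc 0 M :=
  ⟨le_max_left _ _, max_le hM (min_le_left _ _)⟩

theorem continuous_fill (M : ℝ) : Continuous fun p : ℝ × ℝ => fill M p.1 p.2 := by
  unfold fill; fun_prop

theorem measurable_fill (M x : ℝ) : Measurable (fill M x) := by
  unfold fill; fun_prop

/-- Convexity of the cycle cost in the waiting period, linearized at the water level. -/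
theorem cycleCost_fill_add_le (hgc : Continuous g) (hgm : Monotone g) {M : ℝ} (x y y' : ℝ) {z : ℝ}
    (hz : z ∈ Set.Icc 0 M) :
    cycleCost g y (fill M x y) y' + penalty g (x + y') * (z - fill M x y) ≤ cycleCost g y z y' := by
  have hi : ∀ a b : ℝ, IntervalIntegrable (penalty g) volume a b :=
    fun a b => (continuous_penalty hgc).intervalIntegrable a b
  have h : cycleCost g y z y' - cycleCost g y (fill M x y) y' =
      ∫ t in (y + fill M x y + y')..(y + z + y'), penalty g t :=
    intervalIntegral.integral_interval_sub_left (hi _ _) (hi _ _)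
  suffices penalty g (x + y') * (z - fill M x y) ≤
      ∫ t in (y + fill M x y + y')..(y + z + y'), penalty g t by linarith
  rcases le_total (fill M x y) z with hle | hle
  · have hconst : penalty g (x + y') * (z - fill M x y) =
        ∫ _t in (y + fill M x y + y')..(y + z + y'), penalty g (x + y') := by
      rw [intervalIntegral.integral_const, smul_eq_mul]; ring
    rcases hle.eq_or_lt with heq | hlt
    · simp [← heq]
    rw [hconst]
    refine intervalIntegral.integral_mono_on (by linarith) (by simp) (hi _ _) fun t ht => ?_
    refine penalty_mono hgm ?_
    -- Since `fill M x y < z ≤ M`, the cap `M` is not active, so all ages in this interval are at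
    -- least `x + y'`.
    have h1 : min M (x - y) ≤ fill M x y := le_max_right _ _
    have h2 : x - y ≤ fill M x y := by
      rcases min_le_iff.1 h1 with h3 | h3
      · linarith [hz.2]
      · exact h3
    linarith [ht.1]
  · have hconst : penalty g (x + y') * (z - fill M x y) =
        -∫ _t in (y + z + y')..(y + fill M x y + y'), penalty g (x + y') := by
      rw [intervalIntegral.integral_const, smul_eq_mul]; ring
    rcases hle.eq_or_lt with heq | hlt
    · simp [heq]
    rw [hconst, intervalIntegral.integral_symm (y + z + y'), neg_le_neg_iff]
    refine intervalIntegral.integral_mono_on (by linarith) (hi _ _) (by simp) fun t ht => ?_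
    refine penalty_mono hgm ?_
    -- Since `fill M x y > z ≥ 0`, the lower clip is not active, so all ages in this interval are at
    -- most `x + y'`.
    have h2 : fill M x y ≤ x - y := by
      have h3 : 0 < fill M x y := hz.1.trans_lt hlt
      have h4 : fill M x y = min M (x - y) :=
        max_eq_right (le_of_lt ((lt_max_iff.1 h3).resolve_left (lt_irrefl _)))
      exact h4.trans_le (min_le_right _ _)
    linarith [ht.2]

end Penalty

/-! ### Sample paths -/

section Paths

variable {Ω : Type*} {Y Z : ℕ → Ω → ℝ} {ω : Ω} {B_L B_U M : ℝ}

/-- A sample path along which all delays lie in `[B_L, B_U]` and all waiting periods in `[0, M]`. -/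
structure RegularPath (Y Z : ℕ → Ω → ℝ) (B_L B_U M : ℝ) (ω : Ω) : Prop where
  pos : 0 < B_L
  delay_mem : ∀ j, Y j ω ∈ Set.Icc B_L B_U
  wait_mem : ∀ j, Z j ω ∈ Set.Icc 0 M

theorem exists_cycle_lt {t : ℝ} (ht : 0 ≤ t) {n : ℕ}
    (hn : t < deliveryTime Y Z n ω) :
    ∃ j < n, t ∈ Set.Ico (deliveryTime Y Z j ω) (deliveryTime Y Z (j + 1) ω) := by
  induction n with
  | zero => simp [deliveryTime] at hn; linarith
  | succ n ih =>
    by_cases hlt : t < deliveryTime Y Z n ω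
    · obtain ⟨j, hj, hjt⟩ := ih hlt
      exact ⟨j, by omega, hjt⟩
    · exact ⟨n, by omega, not_lt.1 hlt, hn⟩

namespace RegularPath

theorem deliveryTime_succ_mem (h : RegularPath Y Z B_L B_U M ω) (j : ℕ) :
    deliveryTime Y Z (j + 1) ω - deliveryTime Y Z j ω ∈ Set.Icc B_L (M + B_U) := by
  have h1 := h.delay_mem (j + 1)
  have h2 := h.wait_mem j
  have h3 : deliveryTime Y Z (j + 1) ω = deliveryTime Y Z j ω + Z j ω + Y (j + 1) ω := rfl
  exact ⟨by linarith [h1.1, h2.1], by linarith [h1.2, h2.2]⟩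

theorem deliveryTime_mono (h : RegularPath Y Z B_L B_U M ω) :
    Monotone fun j => deliveryTime Y Z j ω :=
  monotone_nat_of_le_succ fun j => by linarith [(h.deliveryTime_succ_mem j).1, h.pos]

theorem mul_le_deliveryTime (h : RegularPath Y Z B_L B_U M ω) (j : ℕ) :
    j * B_L ≤ deliveryTime Y Z j ω := by
  induction j with
  | zero => simp [deliveryTime]
  | succ j ih => push_cast; linarith [(h.deliveryTime_succ_mem j).1]

theorem deliveryTime_nonneg (h : RegularPath Y Z B_L B_U M ω) (j : ℕ) :
    0 ≤ deliveryTime Y Z j ω :=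
  (mul_nonneg (Nat.cast_nonneg j) h.pos.le).trans (h.mul_le_deliveryTime j)

theorem requestTime_mono (h : RegularPath Y Z B_L B_U M ω) :
    Monotone fun j => requestTime Y Z j ω :=
  monotone_nat_of_le_succ fun j => by
    rw [requestTime_succ, requestTime]
    linarith [(h.wait_mem j).1, (h.delay_mem j).1, h.pos]

/-- Request times increase with the index, so the maximum in the age is attained at the last
delivered update. -/
theorem age_eq (h : RegularPath Y Z B_L B_U M ω) {j : ℕ} {t : ℝ}
    (ht : t ∈ Set.Ico (deliveryTime Y Z j ω) (deliveryTime Y Z (j + 1) ω)) :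
    age Y Z t ω = t - deliveryTime Y Z j ω + Y j ω := by
  have hgr : IsGreatest {r : ℝ | ∃ j : ℕ, deliveryTime Y Z j ω ≤ t ∧ r = requestTime Y Z j ω}
      (requestTime Y Z j ω) := by
    refine ⟨⟨j, ht.1, rfl⟩, ?_⟩
    rintro r ⟨i, hi, rfl⟩
    refine h.requestTime_mono ?_
    by_contra hij
    exact absurd (h.deliveryTime_mono (Nat.succ_le_of_lt (not_le.1 hij)))
      (not_le.2 (hi.trans_lt ht.2))
  rw [age, lastGeneration, hgr.csSup_eq, requestTime]
  ring

theorem exists_cycle (h : RegularPath Y Z B_L B_U M ω) {t : ℝ} (ht : 0 ≤ t) :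
    ∃ j, t ∈ Set.Ico (deliveryTime Y Z j ω) (deliveryTime Y Z (j + 1) ω) := by
  obtain ⟨n, hn⟩ := exists_nat_gt (t / B_L)
  obtain ⟨j, -, hj⟩ := exists_cycle_lt ht
    (((div_lt_iff₀ h.pos).1 hn).trans_le (h.mul_le_deliveryTime n))
  exact ⟨j, hj⟩

theorem age_le (h : RegularPath Y Z B_L B_U M ω) {t : ℝ} (ht : 0 ≤ t) :
    age Y Z t ω ≤ 2 * B_U + M := by
  obtain ⟨j, hj⟩ := h.exists_cycle ht
  rw [h.age_eq hj]
  linarith [hj.2, (h.deliveryTime_succ_mem j).2, (h.delay_mem j).2]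

end RegularPath

/-- The penalty at time `t`, if update `j` is the freshest delivered one then, and `0` otherwise. -/
def updatePenalty (g : ℝ≥0 → ℝ≥0) (Y Z : ℕ → Ω → ℝ) (j : ℕ) (t : ℝ) (ω : Ω) : ℝ≥0∞ :=
  (Set.Ico (deliveryTime Y Z j ω) (deliveryTime Y Z (j + 1) ω)).indicator
    (fun t => ENNReal.ofReal (penalty g (t - deliveryTime Y Z j ω + Y j ω))) t

variable {g : ℝ≥0 → ℝ≥0}

/-- During the cycle the age runs at unit speed from `Y j` to `Y j + Z j + Y (j + 1)`; a translation
of the time variable gives the cycle cost. -/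
theorem lintegral_updatePenalty (hgc : Continuous g) {j : ℕ} (h : 0 ≤ Z j ω + Y (j + 1) ω) :
    ∫⁻ t, updatePenalty g Y Z j t ω =
      ENNReal.ofReal (cycleCost g (Y j ω) (Z j ω) (Y (j + 1) ω)) := by
  have hc := continuous_penalty hgc
  have hD : deliveryTime Y Z (j + 1) ω = deliveryTime Y Z j ω + Z j ω + Y (j + 1) ω := rfl
  set D := deliveryTime Y Z j ω
  have hle : D ≤ deliveryTime Y Z (j + 1) ω := by linarith
  unfold updatePenalty
  rw [lintegral_indicator measurableSet_Ico, restrict_Ico_eq_restrict_Ioc,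
    ← ofReal_integral_eq_lintegral_ofReal]
  · rw [← intervalIntegral.integral_of_le hle, cycleCost]
    congr 1
    have := intervalIntegral.integral_comp_sub_right (a := D) (b := deliveryTime Y Z (j + 1) ω)
      (penalty g) (D - Y j ω)
    rw [show D - (D - Y j ω) = Y j ω by ring,
      show deliveryTime Y Z (j + 1) ω - (D - Y j ω) = Y j ω + Z j ω + Y (j + 1) ω by
        rw [hD]; ring] at this
    rw [← this]
    congr 1
    funext t
    congr 1
    ring
  · exact ((hc.comp (by fun_prop : Continuous fun t : ℝ => t - D + Y j ω)).integrableOn_Icc).mono_set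
      Set.Ioc_subset_Icc_self
  · exact Eventually.of_forall fun _ => penalty_nonneg _ _

namespace RegularPath

theorem agePenalty_eq (h : RegularPath Y Z B_L B_U M ω) {j : ℕ} {t : ℝ}
    (ht : t ∈ Set.Ico (deliveryTime Y Z j ω) (deliveryTime Y Z (j + 1) ω)) :
    agePenalty g Y Z t ω = updatePenalty g Y Z j t ω := by
  rw [updatePenalty, Set.indicator_of_mem ht, agePenalty_eq_ofReal, h.age_eq ht]

theorem agePenalty_le (h : RegularPath Y Z B_L B_U M ω) (hg : Monotone g) {t : ℝ} (ht : 0 ≤ t) :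
    agePenalty g Y Z t ω ≤ ENNReal.ofReal (penalty g (2 * B_U + M)) := by
  rw [agePenalty_eq_ofReal]
  exact ENNReal.ofReal_le_ofReal (penalty_mono hg (h.age_le ht))

theorem updatePenalty_le (h : RegularPath Y Z B_L B_U M ω) (hg : Monotone g) (j : ℕ) (t : ℝ) :
    updatePenalty g Y Z j t ω ≤ ENNReal.ofReal (penalty g (2 * B_U + M)) := by
  by_cases ht : t ∈ Set.Ico (deliveryTime Y Z j ω) (deliveryTime Y Z (j + 1) ω)
  · rw [← h.agePenalty_eq ht]
    exact h.agePenalty_le hg ((h.deliveryTime_nonneg j).trans ht.1)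
  · simp [updatePenalty, ht]

theorem sum_cycleCost_le_lintegral (h : RegularPath Y Z B_L B_U M ω) (hgc : Continuous g) (n : ℕ) :
    ∑ j ∈ Finset.range n, ENNReal.ofReal (cycleCost g (Y j ω) (Z j ω) (Y (j + 1) ω)) ≤
      ∫⁻ t in Set.Icc 0 (deliveryTime Y Z n ω), agePenalty g Y Z t ω := by
  have hkey : ∀ n, ∑ j ∈ Finset.range n, ENNReal.ofReal (cycleCost g (Y j ω) (Z j ω) (Y (j + 1) ω))
      ≤ ∫⁻ t in Set.Ico 0 (deliveryTime Y Z n ω), agePenalty g Y Z t ω := by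
    intro n
    induction n with
    | zero => simp
    | succ n ih =>
      have hle : deliveryTime Y Z n ω ≤ deliveryTime Y Z (n + 1) ω :=
        h.deliveryTime_mono (Nat.le_succ n)
      have h0 : 0 ≤ Z n ω + Y (n + 1) ω := by
        linarith [(h.wait_mem n).1, (h.delay_mem (n + 1)).1, h.pos]
      rw [Finset.sum_range_succ, ← Set.Ico_union_Ico_eq_Ico (h.deliveryTime_nonneg n) hle,
        lintegral_union measurableSet_Ico (Set.Ico_disjoint_Ico_same)]
      gcongr
      rw [← lintegral_updatePenalty hgc h0]
      unfold updatePenalty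
      rw [lintegral_indicator measurableSet_Ico]
      refine setLIntegral_mono' measurableSet_Ico fun t ht => ?_
      rw [h.agePenalty_eq ht, updatePenalty, Set.indicator_of_mem ht]
  exact (hkey n).trans (lintegral_mono_set Set.Ico_subset_Icc_self)

end RegularPath

end Paths

end

end PullOrWait

/-! ### Means per cycle under water-filling, as functions of the level -/

namespace PullOrWait

noncomputable section

variable {Ω : Type*} [MeasurableSpace Ω] {P : Measure Ω} {Y : ℕ → Ω → ℝ} {B_L B_U M : ℝ}
  {g : ℝ≥0 → ℝ≥0}

/-- The transmission delays are i.i.d. with values in `[B_L, B_U]`, where `B_L > 0`. -/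
structure IsDelay (P : Measure Ω) (Y : ℕ → Ω → ℝ) (B_L B_U : ℝ) : Prop where
  measurable : ∀ j, Measurable (Y j)
  indep : iIndepFun Y P
  ident : ∀ j, IdentDistrib (Y j) (Y 0) P P
  pos : 0 < B_L
  mem : ∀ j, ∀ᵐ ω ∂P, Y j ω ∈ Set.Icc B_L B_U

/-- The expected time per update under water-filling with level `x`. -/
def meanCycle (P : Measure Ω) (Y : ℕ → Ω → ℝ) (M x : ℝ) : ℝ :=
  ∫ ω, (Y 0 ω + fill M x (Y 0 ω)) ∂P

/-- The expected penalty per update under water-filling with level `x`. -/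
def meanCost (P : Measure Ω) (g : ℝ≥0 → ℝ≥0) (Y : ℕ → Ω → ℝ) (M x : ℝ) : ℝ :=
  ∫ ω, cycleCost g (Y 0 ω) (fill M x (Y 0 ω)) (Y 1 ω) ∂P

theorem integrable_of_mem_Icc [IsFiniteMeasure P] {f : Ω → ℝ} (hf : Measurable f) {a b : ℝ}
    (h : ∀ᵐ ω ∂P, f ω ∈ Set.Icc a b) : Integrable f P := by
  refine Integrable.of_bound hf.aestronglyMeasurable (max |a| |b|) ?_
  filter_upwards [h] with ω hω
  exact abs_le_max_abs_abs hω.1 hω.2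

theorem measurable_deliveryTime {Z : ℕ → Ω → ℝ} (hY : ∀ j, Measurable (Y j))
    (hZ : ∀ j, Measurable (Z j)) : ∀ j, Measurable (deliveryTime Y Z j)
  | 0 => measurable_const
  | j + 1 => ((measurable_deliveryTime hY hZ j).add (hZ j)).add (hY (j + 1))

theorem deliveryTime_eq_sum {Ω : Type*} (Y Z : ℕ → Ω → ℝ) (n : ℕ) (ω : Ω) :
    deliveryTime Y Z n ω = ∑ j ∈ Finset.range n, (Z j ω + Y (j + 1) ω) := by
  induction n with
  | zero => simp [deliveryTime]
  | succ n ih => rw [Finset.sum_range_succ, ← ih, deliveryTime]; ring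

namespace IsDelay

theorem ae_regularPath (h : IsDelay P Y B_L B_U) {Z : ℕ → Ω → ℝ}
    (hZ : ∀ j ω, Z j ω ∈ Set.Icc 0 M) : ∀ᵐ ω ∂P, RegularPath Y Z B_L B_U M ω := by
  filter_upwards [ae_all_iff.2 h.mem] with ω hω
  exact ⟨h.pos, hω, fun j => hZ j ω⟩

theorem integral_eq (h : IsDelay P Y B_L B_U) (j : ℕ) : ∫ ω, Y j ω ∂P = ∫ ω, Y 0 ω ∂P :=
  (h.ident j).integral_eq

theorem integral_fill_eq (h : IsDelay P Y B_L B_U) (x : ℝ) (j : ℕ) :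
    ∫ ω, fill M x (Y j ω) ∂P = ∫ ω, fill M x (Y 0 ω) ∂P :=
  ((h.ident j).comp (measurable_fill M x)).integral_eq

theorem ae_cycleCost_mem (h : IsDelay P Y B_L B_U) (hgc : Continuous g) (hgm : Monotone g)
    {z : Ω → ℝ} (hz : ∀ ω, z ω ∈ Set.Icc 0 M) (i j : ℕ) :
    ∀ᵐ ω ∂P, cycleCost g (Y i ω) (z ω) (Y j ω) ∈
      Set.Icc 0 (penalty g (2 * B_U + M) * (M + B_U)) := by
  filter_upwards [h.mem i, h.mem j] with ω hi hj
  have h0 : 0 ≤ z ω + Y j ω := by linarith [(hz ω).1, hj.1, h.pos]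
  exact ⟨cycleCost_nonneg h0, cycleCost_le hgc hgm h0 (by linarith [(hz ω).2, hi.2, hj.2])
    (by linarith [(hz ω).2, hj.2])⟩

theorem meanCost_nonneg (h : IsDelay P Y B_L B_U) (hM : 0 ≤ M) (hgc : Continuous g)
    (hgm : Monotone g) (x : ℝ) : 0 ≤ meanCost P g Y M x := by
  refine integral_nonneg_of_ae ?_
  filter_upwards [h.ae_cycleCost_mem hgc hgm (fun ω => fill_mem hM x (Y 0 ω)) 0 1] with ω hω
  exact hω.1

variable [IsProbabilityMeasure P]

theorem integrable (h : IsDelay P Y B_L B_U) (j : ℕ) : Integrable (Y j) P :=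
  integrable_of_mem_Icc (h.measurable j) (h.mem j)

theorem integrable_fill (h : IsDelay P Y B_L B_U) (hM : 0 ≤ M) (x : ℝ) (j : ℕ) :
    Integrable (fun ω => fill M x (Y j ω)) P :=
  integrable_of_mem_Icc ((measurable_fill M x).comp (h.measurable j))
    (Eventually.of_forall fun _ => fill_mem hM x _)

theorem meanCycle_eq (h : IsDelay P Y B_L B_U) (hM : 0 ≤ M) (x : ℝ) :
    meanCycle P Y M x = ∫ ω, Y 0 ω ∂P + ∫ ω, fill M x (Y 0 ω) ∂P :=
  integral_add (h.integrable 0) (h.integrable_fill hM x 0)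

theorem meanCycle_pos (h : IsDelay P Y B_L B_U) (hM : 0 ≤ M) (x : ℝ) : 0 < meanCycle P Y M x := by
  have h1 : ∫ _ω, B_L ∂P ≤ meanCycle P Y M x := by
    refine integral_mono_ae (integrable_const _)
      ((h.integrable 0).add (h.integrable_fill hM x 0)) ?_
    filter_upwards [h.mem 0] with ω hω
    linarith [hω.1, (fill_mem hM x (Y 0 ω)).1]
  simp only [integral_const, probReal_univ, one_smul] at h1
  exact h.pos.trans_le h1

theorem continuous_integral_fill (h : IsDelay P Y B_L B_U) (hM : 0 ≤ M) :
    Continuous fun x => ∫ ω, fill M x (Y 0 ω) ∂P := by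
  refine continuous_of_dominated (bound := fun _ => M) (fun x => ?_) (fun x => ?_)
    (integrable_const _) ?_
  · exact ((measurable_fill M x).comp (h.measurable 0)).aestronglyMeasurable
  · refine Eventually.of_forall fun ω => ?_
    rw [Real.norm_eq_abs, abs_of_nonneg (fill_mem hM x _).1]
    exact (fill_mem hM x _).2
  · exact Eventually.of_forall fun ω =>
      (continuous_fill M).comp (by fun_prop : Continuous fun x : ℝ => (x, Y 0 ω))

theorem continuous_meanCycle (h : IsDelay P Y B_L B_U) (hM : 0 ≤ M) :
    Continuous (meanCycle P Y M) := by
  rw [funext (h.meanCycle_eq hM)]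
  exact continuous_const.add (h.continuous_integral_fill hM)

theorem integrable_cycleCost (h : IsDelay P Y B_L B_U) (hgc : Continuous g) (hgm : Monotone g)
    {z : Ω → ℝ} (hzm : Measurable z) (hz : ∀ ω, z ω ∈ Set.Icc 0 M) (i j : ℕ) :
    Integrable (fun ω => cycleCost g (Y i ω) (z ω) (Y j ω)) P :=
  integrable_of_mem_Icc (measurable_cycleCost hgc (h.measurable i) hzm (h.measurable j))
    (h.ae_cycleCost_mem hgc hgm hz i j)

theorem continuous_meanCost (h : IsDelay P Y B_L B_U) (hM : 0 ≤ M) (hgc : Continuous g)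
    (hgm : Monotone g) : Continuous (meanCost P g Y M) := by
  refine continuous_of_dominated (bound := fun _ => penalty g (2 * B_U + M) * (M + B_U))
    (fun x => ?_) (fun x => ?_) (integrable_const _) ?_
  · exact (measurable_cycleCost hgc (h.measurable 0)
      ((measurable_fill M x).comp (h.measurable 0)) (h.measurable 1)).aestronglyMeasurable
  · filter_upwards [h.ae_cycleCost_mem hgc hgm (fun ω => fill_mem hM x (Y 0 ω)) 0 1] with ω hω
    rw [Real.norm_eq_abs, abs_of_nonneg hω.1]
    exact hω.2
  · refine Eventually.of_forall fun ω => ?_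
    have h1 : Continuous fun x : ℝ => fill M x (Y 0 ω) :=
      (continuous_fill M).comp (by fun_prop : Continuous fun x : ℝ => (x, Y 0 ω))
    exact (continuous_cycleCost hgc).comp
      (continuous_const.prodMk (h1.prodMk continuous_const))

/-- The cost is a function of `(Y j, Y (j + 1))`, which has the law of `(Y 0, Y 1)`. -/
theorem integral_cycleCost_fill_eq (h : IsDelay P Y B_L B_U) (hgc : Continuous g) (x : ℝ) (j : ℕ) :
    ∫ ω, cycleCost g (Y j ω) (fill M x (Y j ω)) (Y (j + 1) ω) ∂P = meanCost P g Y M x := by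
  have hid := IdentDistrib.prodMk (h.ident j) ((h.ident (j + 1)).trans (h.ident 1).symm)
    (h.indep.indepFun (Nat.succ_ne_self j).symm) (h.indep.indepFun zero_ne_one)
  have hu : Measurable fun p : ℝ × ℝ => cycleCost g p.1 (fill M x p.1) p.2 :=
    measurable_cycleCost hgc measurable_fst ((measurable_fill M x).comp measurable_fst)
      measurable_snd
  exact (hid.comp hu).integral_eq

/-- At level `B_L` one almost surely never waits, at level `B_U + M` always for `M`; the
intermediate value theorem gives the rest. -/
theorem exists_level (h : IsDelay P Y B_L B_U) (hM : 0 ≤ M) {c : ℝ} (hc : c ∈ Set.Icc 0 M) :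
    ∃ x ∈ Set.Icc B_L (B_U + M), ∫ ω, fill M x (Y 0 ω) ∂P = c := by
  have hle : B_L ≤ B_U + M := by
    obtain ⟨ω, hω⟩ := (h.mem 0).exists
    linarith [hω.1, hω.2]
  have h0 : ∫ ω, fill M B_L (Y 0 ω) ∂P = 0 := by
    rw [integral_eq_zero_of_ae]
    filter_upwards [h.mem 0] with ω hω
    exact max_eq_left ((min_le_right _ _).trans (by linarith [hω.1]))
  have h1 : ∫ ω, fill M (B_U + M) (Y 0 ω) ∂P = M := by
    have : (fun ω => fill M (B_U + M) (Y 0 ω)) =ᵐ[P] fun _ => M := by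
      filter_upwards [h.mem 0] with ω hω
      rw [fill, min_eq_left (by linarith [hω.2]), max_eq_right hM]
    rw [integral_congr_ae this]
    simp
  have := intermediate_value_Icc hle (h.continuous_integral_fill hM).continuousOn
  rw [h0, h1] at this
  exact this hc

end IsDelay

/-! ### The lower bound on the time average -/

namespace CausalPolicy

variable [IsProbabilityMeasure P]

theorem integrable_wait (π : CausalPolicy P Y M) (j : ℕ) : Integrable (π.wait j) P :=
  integrable_of_mem_Icc (π.measurable_wait j) (Eventually.of_forall (π.wait_mem j))

/-- Expectation of the tangent inequality `cycleCost_fill_add_le`. The level `x` is free, and the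
factor of the linear term is the same for all `j`, so these terms can be made to cancel in a sum
over `j`. -/
theorem integral_cost_ge (h : IsDelay P Y B_L B_U) (hM : 0 ≤ M) (hgc : Continuous g)
    (hgm : Monotone g) (π : CausalPolicy P Y M) (x : ℝ) (j : ℕ) :
    meanCost P g Y M x + (∫ ω, penalty g (x + Y 0 ω) ∂P) *
        (∫ ω, π.wait j ω ∂P - ∫ ω, fill M x (Y 0 ω) ∂P) ≤
      ∫ ω, cycleCost g (Y j ω) (π.wait j ω) (Y (j + 1) ω) ∂P := by
  have hpm : Measurable (penalty g) := (continuous_penalty hgc).measurable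
  have hpx : Measurable fun y => penalty g (x + y) := hpm.comp (measurable_const_add x)
  -- Causality enters here: the slope depends only on the next delay, the difference of waits only
  -- on the past.
  have hind : IndepFun (fun ω => penalty g (x + Y (j + 1) ω))
      (fun ω => π.wait j ω - fill M x (Y j ω)) P := by
    have hu : Measurable fun v : Fin (j + 1) → ℝ × ℝ =>
        (v (Fin.last j)).2 - fill M x (v (Fin.last j)).1 :=
      (measurable_snd.comp (measurable_pi_apply _)).sub
        ((measurable_fill M x).comp (measurable_fst.comp (measurable_pi_apply _)))
    have hv : Measurable fun v : ℕ → ℝ => penalty g (x + v 0) := hpx.comp (measurable_pi_apply 0)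
    exact ((π.causal j).comp hu hv).symm
  have hi1 : Integrable (fun ω => penalty g (x + Y (j + 1) ω)) P := by
    refine integrable_of_mem_Icc (a := 0) (b := penalty g (x + B_U))
      (hpx.comp (h.measurable (j + 1))) ?_
    filter_upwards [h.mem (j + 1)] with ω hω
    exact ⟨penalty_nonneg _ _, penalty_mono hgm (by linarith [hω.2])⟩
  have hi2 : Integrable (fun ω => π.wait j ω - fill M x (Y j ω)) P :=
    (π.integrable_wait j).sub (h.integrable_fill hM x j)
  have hfillm : Measurable fun ω => fill M x (Y j ω) :=
    (measurable_fill M x).comp (h.measurable j)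
  have hi3 := h.integrable_cycleCost (g := g) hgc hgm hfillm (fun ω => fill_mem hM x _) j (j + 1)
  have hprod := hind.integral_fun_mul_eq_mul_integral hi1.aestronglyMeasurable
    hi2.aestronglyMeasurable
  have hpen : ∫ ω, penalty g (x + Y (j + 1) ω) ∂P = ∫ ω, penalty g (x + Y 0 ω) ∂P :=
    ((h.ident (j + 1)).comp hpx).integral_eq
  rw [hpen, integral_sub (π.integrable_wait j) (h.integrable_fill hM x j),
    h.integral_fill_eq x j] at hprod
  have hi4 : Integrable (fun ω => penalty g (x + Y (j + 1) ω) * (π.wait j ω - fill M x (Y j ω))) P :=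
    hind.integrable_mul hi1 hi2
  rw [← hprod, ← h.integral_cycleCost_fill_eq hgc x j,
    ← integral_add hi3 hi4]
  refine integral_mono (hi3.add hi4)
    (h.integrable_cycleCost hgc hgm (π.measurable_wait j) (π.wait_mem j) j (j + 1)) fun ω => ?_
  exact cycleCost_fill_add_le hgc hgm x _ _ (π.wait_mem j ω)

/-- A policy's costs over `n` updates dominate those of water-filling at the same mean wait. -/
theorem exists_level (h : IsDelay P Y B_L B_U) (hM : 0 ≤ M) (π : CausalPolicy P Y M) (n : ℕ) :
    ∃ x ∈ Set.Icc B_L (B_U + M),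
      n * ∫ ω, fill M x (Y 0 ω) ∂P = ∑ j ∈ Finset.range n, ∫ ω, π.wait j ω ∂P := by
  have hw : ∀ j, ∫ ω, π.wait j ω ∂P ∈ Set.Icc 0 M := fun j => by
    refine ⟨integral_nonneg fun ω => (π.wait_mem j ω).1, ?_⟩
    calc ∫ ω, π.wait j ω ∂P ≤ ∫ _ω, M ∂P :=
          integral_mono (π.integrable_wait j) (integrable_const _) fun ω => (π.wait_mem j ω).2
      _ = M := by simp
  rcases Nat.eq_zero_or_pos n with rfl | hn
  · obtain ⟨x, hx, -⟩ := h.exists_level hM (c := 0) ⟨le_rfl, hM⟩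
    exact ⟨x, hx, by simp⟩
  · have hn' : (0 : ℝ) < n := Nat.cast_pos.2 hn
    obtain ⟨x, hx, hxc⟩ := h.exists_level hM
      (c := (∑ j ∈ Finset.range n, ∫ ω, π.wait j ω ∂P) / n) ⟨by
        exact div_nonneg (Finset.sum_nonneg fun j _ => (hw j).1) hn'.le, by
        rw [div_le_iff₀ hn']
        calc _ ≤ ∑ _j ∈ Finset.range n, M := Finset.sum_le_sum fun j _ => (hw j).2
          _ = M * n := by simp [mul_comm]⟩
    exact ⟨x, hx, by rw [hxc]; field_simp⟩

/-- The mean duration involves the waits only through the sum of their means, which `hx` matches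
with water-filling. -/
theorem lintegral_deliveryTime (h : IsDelay P Y B_L B_U) (hM : 0 ≤ M) (π : CausalPolicy P Y M)
    {n : ℕ} {x : ℝ}
    (hx : n * ∫ ω, fill M x (Y 0 ω) ∂P = ∑ j ∈ Finset.range n, ∫ ω, π.wait j ω ∂P) :
    ∫⁻ ω, ENNReal.ofReal (deliveryTime Y π.wait n ω) ∂P =
      ENNReal.ofReal (n * meanCycle P Y M x) := by
  have hi : ∀ j ∈ Finset.range n, Integrable (fun ω => π.wait j ω + Y (j + 1) ω) P :=
    fun j _ => (π.integrable_wait j).add (h.integrable (j + 1))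
  have hnn : 0 ≤ᵐ[P] deliveryTime Y π.wait n := by
    filter_upwards [h.ae_regularPath π.wait_mem] with ω hω using hω.deliveryTime_nonneg n
  rw [← ofReal_integral_eq_lintegral_ofReal _ hnn]
  · congr 1
    simp_rw [deliveryTime_eq_sum]
    rw [integral_finsetSum _ hi]
    simp_rw [integral_add (π.integrable_wait _) (h.integrable _), h.integral_eq]
    rw [Finset.sum_add_distrib, ← hx, h.meanCycle_eq hM]
    simp; ring
  · rw [funext (deliveryTime_eq_sum Y π.wait n)]
    exact integrable_finsetSum _ hi

theorem lintegral_interdelivery (h : IsDelay P Y B_L B_U) (hM : 0 ≤ M) (π : CausalPolicy P Y M)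
    {n : ℕ} {x : ℝ}
    (hx : n * ∫ ω, fill M x (Y 0 ω) ∂P = ∑ j ∈ Finset.range n, ∫ ω, π.wait j ω ∂P) :
    ∫⁻ ω, ENNReal.ofReal (∑ j ∈ Finset.range n, (Y j ω + π.wait j ω)) ∂P =
      ENNReal.ofReal (n * meanCycle P Y M x) := by
  have hi : ∀ j ∈ Finset.range n, Integrable (fun ω => Y j ω + π.wait j ω) P :=
    fun j _ => (h.integrable j).add (π.integrable_wait j)
  have hnn : 0 ≤ᵐ[P] fun ω => ∑ j ∈ Finset.range n, (Y j ω + π.wait j ω) := by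
    filter_upwards [h.ae_regularPath π.wait_mem] with ω hω
    exact Finset.sum_nonneg fun j _ => by
      linarith [(hω.delay_mem j).1, (hω.wait_mem j).1, h.pos]
  rw [← ofReal_integral_eq_lintegral_ofReal (integrable_finsetSum _ hi) hnn]
  congr 1
  rw [integral_finsetSum _ hi]
  simp_rw [integral_add (h.integrable _) (π.integrable_wait _), h.integral_eq]
  rw [Finset.sum_add_distrib, ← hx, h.meanCycle_eq hM]
  simp; ring

/-- Summing `integral_cost_ge` over `j < n`, the linear terms add up to zero by the choice of `x` in
`hx`. -/
theorem ofReal_meanCost_le (h : IsDelay P Y B_L B_U) (hM : 0 ≤ M) (hgc : Continuous g)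
    (hgm : Monotone g) (π : CausalPolicy P Y M) {n : ℕ} {x : ℝ}
    (hx : n * ∫ ω, fill M x (Y 0 ω) ∂P = ∑ j ∈ Finset.range n, ∫ ω, π.wait j ω ∂P) :
    ENNReal.ofReal (n * meanCost P g Y M x) ≤
      ∫⁻ ω, (∫⁻ t in Set.Icc 0 (deliveryTime Y π.wait n ω), agePenalty g Y π.wait t ω) ∂P := by
  have hi : ∀ j ∈ Finset.range n,
      Integrable (fun ω => cycleCost g (Y j ω) (π.wait j ω) (Y (j + 1) ω)) P :=
    fun j _ => h.integrable_cycleCost hgc hgm (π.measurable_wait j) (π.wait_mem j) j (j + 1)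
  have hnn : ∀ᵐ ω ∂P, ∀ j, 0 ≤ cycleCost g (Y j ω) (π.wait j ω) (Y (j + 1) ω) :=
    ae_all_iff.2 fun j => (h.ae_cycleCost_mem hgc hgm (π.wait_mem j) j (j + 1)).mono
      fun ω hω => hω.1
  have h1 : n * meanCost P g Y M x ≤
      ∫ ω, ∑ j ∈ Finset.range n, cycleCost g (Y j ω) (π.wait j ω) (Y (j + 1) ω) ∂P := by
    rw [integral_finsetSum _ hi]
    refine le_trans (le_of_eq ?_)
      (Finset.sum_le_sum fun j _ => integral_cost_ge h hM hgc hgm π x j)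
    rw [Finset.sum_add_distrib, ← Finset.mul_sum, Finset.sum_sub_distrib, ← hx]
    simp
  refine (ENNReal.ofReal_le_ofReal h1).trans ?_
  rw [ofReal_integral_eq_lintegral_ofReal (integrable_finsetSum _ hi)
    (hnn.mono fun ω hω => Finset.sum_nonneg fun j _ => hω j)]
  refine lintegral_mono_ae ?_
  filter_upwards [hnn, h.ae_regularPath π.wait_mem] with ω hω hr
  rw [ENNReal.ofReal_sum_of_nonneg fun j _ => hω j]
  exact hr.sum_cycleCost_le_lintegral hgc n

/-- Some water-filling level is as good as a given policy: it meets the power constraint in the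
mean, and its mean penalty per mean cycle is at most the time average penalty of the policy. -/
theorem exists_level_le_timeAverage (h : IsDelay P Y B_L B_U) (hM : 0 ≤ M) (hgc : Continuous g)
    (hgm : Monotone g) (π : CausalPolicy P Y M) {fmax : ℝ≥0∞} (hf : MeetsPower P Y π.wait fmax) :
    ∃ x, fmax⁻¹ ≤ ENNReal.ofReal (meanCycle P Y M x) ∧
      ENNReal.ofReal (meanCost P g Y M x / meanCycle P Y M x) ≤ timeAverage P g Y π.wait := by
  choose x hxmem hx using fun n => exists_level h hM π n
  obtain ⟨x₀, -, φ, hφ, hlim⟩ := isCompact_Icc.tendsto_subseq hxmem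
  have hpos : ∀ n : ℕ, 0 < n → (0 : ℝ) < n := fun n hn => Nat.cast_pos.2 hn
  have hφpos : ∀ᶠ n in atTop, 0 < φ n := hφ.tendsto_atTop.eventually_gt_atTop 0
  refine ⟨x₀, ?_, ?_⟩
  · have ht : Tendsto (fun n => ENNReal.ofReal (meanCycle P Y M (x (φ n)))) atTop
        (nhds (ENNReal.ofReal (meanCycle P Y M x₀))) :=
      ENNReal.tendsto_ofReal (((h.continuous_meanCycle hM).tendsto x₀).comp hlim)
    -- Any `y` below the `liminf` is eventually below the terms of the subsequence `φ`, hence at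
    -- most their limit. The cost bound below uses the same argument with the `limsup`.
    refine hf.trans (le_of_forall_lt_imp_le_of_dense fun y hy => ge_of_tendsto ht ?_)
    have h1 := hφ.tendsto_atTop.eventually (eventually_lt_of_lt_liminf hy)
    filter_upwards [h1, hφpos] with n hn hn0
    rw [lintegral_interdelivery h hM π (hx (φ n)), mul_comm,
      ENNReal.ofReal_mul (h.meanCycle_pos hM _).le, ENNReal.ofReal_natCast,
      ENNReal.mul_div_cancel_right (by exact_mod_cast hn0.ne') (ENNReal.natCast_ne_top _)] at hn
    exact hn.le
  · have ht : Tendsto (fun n => ENNReal.ofReal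
        (meanCost P g Y M (x (φ n)) / meanCycle P Y M (x (φ n)))) atTop
        (nhds (ENNReal.ofReal (meanCost P g Y M x₀ / meanCycle P Y M x₀))) :=
      ENNReal.tendsto_ofReal ((((h.continuous_meanCost hM hgc hgm).tendsto x₀).comp hlim).div
        (((h.continuous_meanCycle hM).tendsto x₀).comp hlim) (h.meanCycle_pos hM x₀).ne')
    refine le_of_forall_gt_imp_ge_of_dense fun y hy => le_of_tendsto ht ?_
    have h1 := hφ.tendsto_atTop.eventually (eventually_lt_of_limsup_lt hy)
    filter_upwards [h1, hφpos] with n hn hn0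
    refine le_trans ?_ hn.le
    rw [lintegral_deliveryTime h hM π (hx (φ n))]
    have hn' := hpos _ hn0
    have hb := h.meanCycle_pos hM (x (φ n))
    rw [← mul_div_mul_left _ _ hn'.ne', ENNReal.ofReal_div_of_pos (mul_pos hn' hb)]
    gcongr
    exact ofReal_meanCost_le h hM hgc hgm π (hx (φ n))

end CausalPolicy

end

end PullOrWait

namespace PullOrWait

noncomputable section

/-! ### Counting queries -/

theorem card_queries_le (a b : ℝ) {T : ℝ} (hT : 0 < T) (s : Finset ℕ) :
    ((s.filter fun k : ℕ => a ≤ k * T ∧ k * T < b).card : ℝ) ≤ max (b - a) 0 / T + 1 := by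
  set S := s.filter fun k : ℕ => a ≤ k * T ∧ k * T < b with hS
  rcases S.eq_empty_or_nonempty with h | h
  · rw [h]
    simp only [Finset.card_empty, Nat.cast_zero]
    have : 0 ≤ max (b - a) 0 / T := div_nonneg (le_max_right _ _) hT.le
    linarith
  · have h0 := (Finset.mem_filter.1 (S.min'_mem h)).2
    have h1 := (Finset.mem_filter.1 (S.max'_mem h)).2
    have hle := S.min'_le _ (S.max'_mem h)
    have hsub : S ⊆ Finset.Icc (S.min' h) (S.max' h) :=
      fun k hk => Finset.mem_Icc.2 ⟨S.min'_le k hk, S.le_max' k hk⟩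
    have hcard := Finset.card_le_card hsub
    rw [Nat.card_Icc] at hcard
    have hc : (S.card : ℝ) ≤ S.max' h + 1 - S.min' h := by
      have : S.card + S.min' h ≤ S.max' h + 1 := by omega
      have h2 : ((S.card + S.min' h : ℕ) : ℝ) ≤ ((S.max' h + 1 : ℕ) : ℝ) := Nat.cast_le.2 this
      push_cast at h2
      linarith
    have h3 : ((S.max' h : ℝ) - S.min' h) ≤ max (b - a) 0 / T := by
      rw [le_div_iff₀ hT]
      refine le_trans ?_ (le_max_left _ _)
      linarith [h0.1, h1.2]
    linarith

/-- Sampling a function at the shifted queries `k * T - s` costs, integrated over one period of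
shifts `s`, at most its integral. -/
theorem lintegral_tsum_shift_le {f : ℝ → ℝ≥0∞} (hf : Measurable f) (a : ℝ) {T : ℝ} (hT : 0 < T) :
    ∫⁻ s in Set.Ico a (a + T), ∑' k : ℕ, f (k * T - s) ≤ ∫⁻ t, f t := by
  have hfk : ∀ k : ℕ, Measurable fun s => f (k * T - s) :=
    fun k => hf.comp (measurable_const_sub _)
  rw [lintegral_tsum fun k => (hfk k).aemeasurable]
  -- As `s` runs through `[a, a + T)`, the point `k * T - s` runs through `(e k, e (k + 1)]`; these
  -- intervals are disjoint.
  let e : ℕ → ℝ := fun k => k * T - T - a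
  have he : Monotone e := fun i j hij => by
    have : (i : ℝ) * T ≤ j * T := by gcongr
    simp only [e]; linarith
  have hk : ∀ k : ℕ, ∫⁻ s in Set.Ico a (a + T), f (k * T - s) =
      ∫⁻ t in Set.Ioc (e k) (e (k + 1)), f t := by
    intro k
    rw [← lintegral_indicator measurableSet_Ico, ← lintegral_indicator measurableSet_Ioc,
      ← lintegral_sub_left_eq_self ((Set.Ioc (e k) (e (k + 1))).indicator f) ((k : ℝ) * T)]
    congr 1
    funext s
    simp only [Set.indicator, Set.mem_Ico, Set.mem_Ioc, e]
    push_cast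
    congr 1
    refine propext ⟨fun h => ⟨by linarith [h.2], by linarith [h.1]⟩,
      fun h => ⟨by linarith [h.2], by linarith [h.1]⟩⟩
  simp_rw [hk]
  have hd : Pairwise (Function.onFun Disjoint fun k => Set.Ioc (e k) (e (k + 1))) :=
    he.pairwise_disjoint_on_Ioc_succ
  rw [← lintegral_iUnion (fun _ => measurableSet_Ioc) hd]
  exact setLIntegral_le_lintegral _ _

section Paths

variable {Ω : Type*} {Y Z : ℕ → Ω → ℝ} {ω : Ω} {B_L B_U M : ℝ} {g : ℝ≥0 → ℝ≥0}

/-- A crude bound, applied only to padding cycles: a cycle of length at most `M + B_U` meets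
boundedly many queries. -/
theorem RegularPath.sum_updatePenalty_le (h : RegularPath Y Z B_L B_U M ω) (hgm : Monotone g)
    {T : ℝ} (hT : 0 < T) (n j : ℕ) :
    ∑ k ∈ Finset.Icc 1 n, updatePenalty g Y Z j (k * T) ω ≤
      ENNReal.ofReal (penalty g (2 * B_U + M) * ((M + B_U) / T + 1)) := by
  have h1 : ∀ k ∈ Finset.Icc 1 n, updatePenalty g Y Z j (k * T) ω ≤
      if deliveryTime Y Z j ω ≤ k * T ∧ k * T < deliveryTime Y Z (j + 1) ω then
        ENNReal.ofReal (penalty g (2 * B_U + M)) else 0 := by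
    intro k _
    split_ifs with hk
    · exact h.updatePenalty_le hgm _ _
    · exact (Set.indicator_of_notMem (s := Set.Ico _ _) hk _).le
  refine (Finset.sum_le_sum h1).trans ?_
  rw [← Finset.sum_filter, Finset.sum_const, nsmul_eq_mul, ← ENNReal.ofReal_natCast,
    ← ENNReal.ofReal_mul (Nat.cast_nonneg _), mul_comm]
  refine ENNReal.ofReal_le_ofReal (mul_le_mul_of_nonneg_left ?_ (penalty_nonneg _ _))
  refine (card_queries_le _ _ hT _).trans ?_
  have h2 := h.deliveryTime_succ_mem j
  gcongr
  exact max_le h2.2 (h.pos.le.trans (h2.1.trans h2.2))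

/-- Queries before the delivery of update `J` belong to one of the first `J` cycles; the later ones
are counted and charged the largest possible penalty. -/
theorem RegularPath.sum_agePenalty_le (h : RegularPath Y Z B_L B_U M ω) (hgm : Monotone g)
    {T : ℝ} (hT : 0 < T) (n J : ℕ) :
    ∑ k ∈ Finset.Icc 1 n, agePenalty g Y Z (k * T) ω ≤
      ∑ j ∈ Finset.range J, ∑ k ∈ Finset.Icc 1 n, updatePenalty g Y Z j (k * T) ω +
        ENNReal.ofReal (penalty g (2 * B_U + M) *
          (max (n * T - deliveryTime Y Z J ω) 0 / T + 2)) := by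
  have h1 : ∀ k ∈ Finset.Icc 1 n, agePenalty g Y Z (k * T) ω ≤
      ∑ j ∈ Finset.range J, updatePenalty g Y Z j (k * T) ω +
      -- The window is extended by `T` so that, though half-open, it contains query `n`; this is the
      -- second unit in `+ 2`.
      if deliveryTime Y Z J ω ≤ k * T ∧ k * T < n * T + T then
        ENNReal.ofReal (penalty g (2 * B_U + M)) else 0 := by
    intro k hk
    have hk0 : (0 : ℝ) ≤ k * T := by positivity
    have hkn : (k : ℝ) * T < n * T + T := by
      have : (k : ℝ) * T ≤ n * T := by
        have := (Finset.mem_Icc.1 hk).2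
        gcongr
      linarith
    by_cases hlt : (k : ℝ) * T < deliveryTime Y Z J ω
    · obtain ⟨j, hj, hjt⟩ := exists_cycle_lt hk0 hlt
      rw [h.agePenalty_eq hjt]
      exact (Finset.single_le_sum (f := fun j => updatePenalty g Y Z j (k * T) ω)
        (fun _ _ => zero_le) (Finset.mem_range.2 hj)).trans le_self_add
    · rw [if_pos ⟨not_lt.1 hlt, hkn⟩]
      exact (h.agePenalty_le hgm hk0).trans le_add_self
  refine (Finset.sum_le_sum h1).trans ?_
  rw [Finset.sum_add_distrib, Finset.sum_comm]
  gcongr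
  rw [← Finset.sum_filter, Finset.sum_const, nsmul_eq_mul, ← ENNReal.ofReal_natCast,
    ← ENNReal.ofReal_mul (Nat.cast_nonneg _), mul_comm]
  refine ENNReal.ofReal_le_ofReal (mul_le_mul_of_nonneg_left ?_ (penalty_nonneg _ _))
  refine (card_queries_le _ _ hT _).trans ?_
  have h2 : max (n * T + T - deliveryTime Y Z J ω) 0 ≤ max (n * T - deliveryTime Y Z J ω) 0 + T :=
    max_le (by linarith [le_max_left (n * T - deliveryTime Y Z J ω) 0])
      (by linarith [le_max_right (n * T - deliveryTime Y Z J ω) 0])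
  have h3 := div_le_div_of_nonneg_right h2 hT.le
  rw [add_div, div_self hT.ne'] at h3
  linarith

end Paths

/-! ### Averaging over shifts -/

section Shift

variable {Ω : Type*} [MeasurableSpace Ω] {P : Measure Ω} {Y : ℕ → Ω → ℝ} {B_L B_U M : ℝ}
  {g : ℝ≥0 → ℝ≥0}

theorem measurable_updatePenalty (hgc : Continuous g) {Z : ℕ → Ω → ℝ} (hY : ∀ j, Measurable (Y j))
    (hZ : ∀ j, Measurable (Z j)) (j : ℕ) :
    Measurable fun p : ℝ × Ω => updatePenalty g Y Z j p.1 p.2 := by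
  have hD : ∀ j, Measurable fun p : ℝ × Ω => deliveryTime Y Z j p.2 :=
    fun j => (measurable_deliveryTime hY hZ j).comp measurable_snd
  have hf : Measurable fun p : ℝ × Ω =>
      ENNReal.ofReal (penalty g (p.1 - deliveryTime Y Z j p.2 + Y j p.2)) :=
    ((continuous_penalty hgc).measurable.comp
      ((measurable_fst.sub (hD j)).add ((hY j).comp measurable_snd))).ennreal_ofReal
  exact hf.indicator ((measurableSet_le (hD j) measurable_fst).inter
    (measurableSet_lt measurable_fst (hD (j + 1))))

/-- Shifting the deliveries by a suitable constant within a given period makes the penalty at the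
queries at most proportional to the time integral of the penalty. -/
theorem exists_shift [IsProbabilityMeasure P] (h : IsDelay P Y B_L B_U) (hM : 0 ≤ M)
    (hgc : Continuous g) (hgm : Monotone g) {Z : ℕ → Ω → ℝ} (hZ : ∀ j, Measurable (Z j)) {x : ℝ}
    (S : Finset ℕ) (hS : ∀ j ∈ S, Z j = fun ω => fill M x (Y j ω)) (a : ℝ) {T : ℝ} (hT : 0 < T) :
    ∃ s ∈ Set.Ico a (a + T),
      ∫⁻ ω, ∑ j ∈ S, ∑' k : ℕ, updatePenalty g Y Z j (k * T - s) ω ∂P ≤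
        ENNReal.ofReal (S.card * (meanCost P g Y M x / T)) := by
  have hum := measurable_updatePenalty hgc h.measurable hZ
  have hjm : ∀ j, Measurable fun p : ℝ × Ω =>
      ∑' k : ℕ, updatePenalty g Y Z j (k * T - p.1) p.2 := fun j =>
    Measurable.tsum fun k =>
      (hum j).comp ((measurable_fst.const_sub ((k : ℝ) * T)).prodMk measurable_snd)
  have hm : Measurable fun p : ℝ × Ω =>
      ∑ j ∈ S, ∑' k : ℕ, updatePenalty g Y Z j (k * T - p.1) p.2 :=
    Finset.measurable_fun_sum _ fun j _ => hjm j
  have hvol : volume (Set.Ico a (a + T)) = ENNReal.ofReal T := by simp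
  have hT0 : ENNReal.ofReal T ≠ 0 := by simpa using hT
  -- Some shift is no worse than the average over the window, whose length `T` gives the factor `1 /
  -- T`.
  obtain ⟨s, hs, hle⟩ := exists_le_setLAverage (μ := volume) (s := Set.Ico a (a + T))
    (f := fun s => ∫⁻ ω, ∑ j ∈ S, ∑' k : ℕ, updatePenalty g Y Z j (k * T - s) ω ∂P)
    (by rw [hvol]; exact hT0) (by rw [hvol]; exact ENNReal.ofReal_ne_top)
    hm.lintegral_prod_right'.aemeasurable
  refine ⟨s, hs, hle.trans ?_⟩
  rw [setLAverage_eq, hvol]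
  have hI : ∫⁻ s in Set.Ico a (a + T),
      ∫⁻ ω, ∑ j ∈ S, ∑' k : ℕ, updatePenalty g Y Z j (k * T - s) ω ∂P ≤
      ENNReal.ofReal (S.card * meanCost P g Y M x) := by
    rw [lintegral_lintegral_swap hm.aemeasurable]
    calc ∫⁻ ω, (∫⁻ s in Set.Ico a (a + T),
            ∑ j ∈ S, ∑' k : ℕ, updatePenalty g Y Z j (k * T - s) ω) ∂P
        ≤ ∫⁻ ω, ∑ j ∈ S, ENNReal.ofReal
            (cycleCost g (Y j ω) (fill M x (Y j ω)) (Y (j + 1) ω)) ∂P := by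
          refine lintegral_mono_ae ?_
          filter_upwards [ae_all_iff.2 h.mem] with ω hω
          have hjω : ∀ j, Measurable fun s : ℝ =>
              ∑' k : ℕ, updatePenalty g Y Z j (k * T - s) ω :=
            fun j => (hjm j).comp measurable_prodMk_right
          rw [lintegral_finsetSum _ fun j _ => hjω j]
          refine Finset.sum_le_sum fun j hj => ?_
          refine (lintegral_tsum_shift_le (f := fun t => updatePenalty g Y Z j t ω)
            ((hum j).comp measurable_prodMk_right) a hT).trans ?_
          have hz : Z j ω = fill M x (Y j ω) := congrFun (hS j hj) ω
          rw [lintegral_updatePenalty hgc, hz]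
          rw [hz]
          linarith [(fill_mem hM x (Y j ω)).1, (hω (j + 1)).1, h.pos]
      _ = ∑ j ∈ S, ENNReal.ofReal (meanCost P g Y M x) := by
          have hfm : ∀ j, Measurable fun ω => fill M x (Y j ω) :=
            fun j => (measurable_fill M x).comp (h.measurable j)
          rw [lintegral_finsetSum _ fun j _ =>
            (measurable_cycleCost hgc (h.measurable j) (hfm j) (h.measurable (j + 1))).ennreal_ofReal]
          refine Finset.sum_congr rfl fun j _ => ?_
          rw [← ofReal_integral_eq_lintegral_ofReal, h.integral_cycleCost_fill_eq hgc]
          · exact h.integrable_cycleCost hgc hgm (hfm j) (fun ω => fill_mem hM x _) j (j + 1)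
          · exact (h.ae_cycleCost_mem hgc hgm (fun ω => fill_mem hM x (Y j ω)) j (j + 1)).mono
              fun ω hω => hω.1
      _ = ENNReal.ofReal (S.card * meanCost P g Y M x) := by
          rw [Finset.sum_const, nsmul_eq_mul, ENNReal.ofReal_mul (Nat.cast_nonneg _),
            ENNReal.ofReal_natCast]
  rw [← mul_div_assoc, ENNReal.ofReal_div_of_pos hT]
  gcongr

end Shift

end

end PullOrWait

namespace PullOrWait

noncomputable section

/-! ### Block policies -/

/-- Block `i` consists of the indices in `[m * i ^ 2, m * (i + 1) ^ 2)`. -/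
def block (m j : ℕ) : ℕ := Nat.sqrt (j / m)

/-- The first `m` indices of each block are used to adjust the phase of the deliveries. -/
def IsPadding (m j : ℕ) : Prop := j < m * block m j ^ 2 + m

instance (m j : ℕ) : Decidable (IsPadding m j) := inferInstanceAs (Decidable (_ < _))

theorem block_eq {m i j : ℕ} (h1 : m * i ^ 2 ≤ j) (h2 : j < m * (i + 1) ^ 2) : block m j = i := by
  have hm : 0 < m := Nat.pos_of_ne_zero fun h => by simp [h] at h2
  refine (Nat.eq_sqrt'.2 ⟨?_, ?_⟩).symm
  · rw [Nat.le_div_iff_mul_le hm]; linarith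
  · rw [Nat.div_lt_iff_lt_mul hm]; linarith

theorem padding_end_le (m i : ℕ) : m * i ^ 2 + m ≤ m * (i + 1) ^ 2 := by
  have : m * (i + 1) ^ 2 = m * i ^ 2 + m + 2 * (m * i) := by ring
  omega

theorem block_eq_of_padding {m i j : ℕ} (h1 : m * i ^ 2 ≤ j) (h2 : j < m * i ^ 2 + m) :
    block m j = i := block_eq h1 (h2.trans_le (padding_end_le m i))

theorem isPadding_of {m i j : ℕ} (h1 : m * i ^ 2 ≤ j) (h2 : j < m * i ^ 2 + m) :
    IsPadding m j := by
  rwa [IsPadding, block_eq_of_padding h1 h2]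

theorem not_isPadding_of {m i j : ℕ} (h1 : m * i ^ 2 + m ≤ j) (h2 : j < m * (i + 1) ^ 2) :
    ¬ IsPadding m j := by
  rw [IsPadding, block_eq (by omega) h2]
  omega

/-- The number of padding indices in the first `r` blocks is `r * m`. -/
theorem sum_padding_le (m r : ℕ) :
    ∑ j ∈ Finset.range (m * r ^ 2), (if IsPadding m j then (1 : ℝ) else 0) ≤ r * m := by
  induction r with
  | zero => simp
  | succ r ih =>
    rw [← Finset.sum_range_add_sum_Ico _ ((Nat.le_add_right _ m).trans (padding_end_le m r)),
      ← Finset.sum_Ico_consecutive _ (Nat.le_add_right _ m) (padding_end_le m r)]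
    have h1 : ∑ j ∈ Finset.Ico (m * r ^ 2) (m * r ^ 2 + m), (if IsPadding m j then (1 : ℝ) else 0)
        ≤ m := by
      calc _ ≤ ∑ _j ∈ Finset.Ico (m * r ^ 2) (m * r ^ 2 + m), (1 : ℝ) :=
            Finset.sum_le_sum fun j _ => by split_ifs <;> simp
        _ = m := by simp
    have h2 : ∑ j ∈ Finset.Ico (m * r ^ 2 + m) (m * (r + 1) ^ 2),
        (if IsPadding m j then (1 : ℝ) else 0) = 0 :=
      Finset.sum_eq_zero fun j hj => by
        rw [if_neg (not_isPadding_of (Finset.mem_Ico.1 hj).1 (Finset.mem_Ico.1 hj).2)]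
    push_cast
    linarith

/-- The decision rule that fills up to level `x`, except at padding indices, where it waits for the
`m`-th part of the change of the shift `s`. -/
def blockRule (M x : ℝ) (m : ℕ) (s : ℕ → ℝ) (j : ℕ) (y : ℝ) : ℝ :=
  if IsPadding m j then (s (block m j + 1) - s (block m j)) / m else fill M x y

theorem measurable_blockRule (M x : ℝ) (m : ℕ) (s : ℕ → ℝ) (j : ℕ) :
    Measurable (blockRule M x m s j) := by
  unfold blockRule
  split_ifs
  · exact measurable_const
  · exact measurable_fill M x

theorem blockRule_mem {M : ℝ} (hM : 0 ≤ M) (x : ℝ) {m : ℕ} {s : ℕ → ℝ}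
    (hs : ∀ i, s (i + 1) - s i ∈ Set.Icc 0 (m * M)) (j : ℕ) (y : ℝ) :
    blockRule M x m s j y ∈ Set.Icc 0 M := by
  unfold blockRule
  split_ifs
  · refine ⟨div_nonneg (hs _).1 (Nat.cast_nonneg m), div_le_of_le_mul₀ (Nat.cast_nonneg m) hM ?_⟩
    rw [mul_comm]
    exact (hs _).2
  · exact fill_mem hM x y

section Paths

variable {Ω : Type*} {Y : ℕ → Ω → ℝ} {ω : Ω} {B_L B_U M x : ℝ} {g : ℝ≥0 → ℝ≥0} {m : ℕ} {s : ℕ → ℝ}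

/-- The waiting periods prescribed by a decision rule. -/
def ruleWait (Y : ℕ → Ω → ℝ) (ζ : ℕ → ℝ → ℝ) (j : ℕ) (ω : Ω) : ℝ := ζ j (Y j ω)

/-- The rule with `s = 0` is the reference: same delays, no wait at padding indices. Each padding
wait increases the lag behind it by the same amount. -/
theorem deliveryTime_padding {i : ℕ}
    (h0 : deliveryTime Y (ruleWait Y (blockRule M x m s)) (m * i ^ 2) ω =
      deliveryTime Y (ruleWait Y (blockRule M x m 0)) (m * i ^ 2) ω + s i) {l : ℕ} (hl : l ≤ m) :
    deliveryTime Y (ruleWait Y (blockRule M x m s)) (m * i ^ 2 + l) ω =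
      deliveryTime Y (ruleWait Y (blockRule M x m 0)) (m * i ^ 2 + l) ω +
        (s i + l * ((s (i + 1) - s i) / m)) := by
  induction l with
  | zero => simpa using h0
  | succ l ih =>
    have hp := isPadding_of (Nat.le_add_right (m * i ^ 2) l) (by omega : _ < m * i ^ 2 + m)
    have hb := block_eq_of_padding (Nat.le_add_right (m * i ^ 2) l) (by omega : _ < m * i ^ 2 + m)
    rw [← add_assoc, deliveryTime, deliveryTime, ih (by omega), ruleWait, ruleWait, blockRule,
      blockRule, if_pos hp, if_pos hp, hb]
    simp only [Pi.zero_apply]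
    push_cast
    ring

/-- Water-filling waits depend on the last delay only, not on the time, so a lag once acquired
persists to the end of the block. -/
theorem deliveryTime_of_padding_end (hm : 0 < m) {i : ℕ}
    (h0 : deliveryTime Y (ruleWait Y (blockRule M x m s)) (m * i ^ 2) ω =
      deliveryTime Y (ruleWait Y (blockRule M x m 0)) (m * i ^ 2) ω + s i) {j : ℕ}
    (hj : m * i ^ 2 + m ≤ j) (hj' : j ≤ m * (i + 1) ^ 2) :
    deliveryTime Y (ruleWait Y (blockRule M x m s)) j ω =
      deliveryTime Y (ruleWait Y (blockRule M x m 0)) j ω + s (i + 1) := by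
  induction j, hj using Nat.le_induction with
  | base =>
    rw [deliveryTime_padding h0 le_rfl]
    have : (m : ℝ) ≠ 0 := by exact_mod_cast hm.ne'
    field_simp
    ring
  | succ j hj ih =>
    have hp := not_isPadding_of hj (by omega : j < m * (i + 1) ^ 2)
    rw [deliveryTime, deliveryTime, ih (by omega), ruleWait, ruleWait, blockRule, blockRule,
      if_neg hp, if_neg hp]
    ring

theorem deliveryTime_block_start (hm : 0 < m) (hs : s 0 = 0) (i : ℕ) :
    deliveryTime Y (ruleWait Y (blockRule M x m s)) (m * i ^ 2) ω =
      deliveryTime Y (ruleWait Y (blockRule M x m 0)) (m * i ^ 2) ω + s i := by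
  induction i with
  | zero => simp [deliveryTime, hs]
  | succ i ih => exact deliveryTime_of_padding_end hm ih (padding_end_le m i) le_rfl

/-- After its padding, block `i` is the unpadded block delayed by `s (i + 1)`. -/
theorem updatePenalty_blockRule (hm : 0 < m) (hs : s 0 = 0) {i j : ℕ} (hj : m * i ^ 2 + m ≤ j)
    (hj' : j < m * (i + 1) ^ 2) (t : ℝ) :
    updatePenalty g Y (ruleWait Y (blockRule M x m s)) j t ω =
      updatePenalty g Y (ruleWait Y (blockRule M x m 0)) j (t - s (i + 1)) ω := by
  have h0 := deliveryTime_block_start (Y := Y) (ω := ω) (M := M) (x := x) hm hs i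
  simp only [updatePenalty, Set.indicator, Set.mem_Ico,
    deliveryTime_of_padding_end hm h0 hj hj'.le,
    deliveryTime_of_padding_end hm h0 (by omega : _ ≤ j + 1) hj', le_sub_iff_add_le,
    sub_lt_iff_lt_add]
  congr 4
  ring

theorem fill_sub_le_blockRule (hM : 0 ≤ M) (hs : ∀ i, s (i + 1) - s i ∈ Set.Icc 0 (m * M))
    (j : ℕ) (y : ℝ) :
    fill M x y - M * (if IsPadding m j then 1 else 0) ≤ blockRule M x m s j y := by
  split_ifs with hp
  · linarith [(fill_mem hM x y).2, (blockRule_mem hM x hs j y).1]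
  · rw [blockRule, if_neg hp]; simp

theorem sum_blockRule_ge (hM : 0 ≤ M) (hs : ∀ i, s (i + 1) - s i ∈ Set.Icc 0 (m * M)) {n r : ℕ}
    (hn : n ≤ m * r ^ 2) :
    ∑ j ∈ Finset.range n, (Y j ω + fill M x (Y j ω)) - M * (r * m) ≤
      ∑ j ∈ Finset.range n, (Y j ω + ruleWait Y (blockRule M x m s) j ω) := by
  have h1 : ∑ j ∈ Finset.range n, (if IsPadding m j then (1 : ℝ) else 0) ≤ r * m :=
    (Finset.sum_le_sum_of_subset_of_nonneg (Finset.range_mono hn)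
      fun j _ _ => by split_ifs <;> simp).trans (sum_padding_le m r)
  have h2 := Finset.sum_le_sum fun j (_ : j ∈ Finset.range n) =>
    add_le_add_right (fill_sub_le_blockRule (x := x) hM hs j (Y j ω)) (Y j ω)
  simp only [← add_sub_assoc, Finset.sum_sub_distrib, ← Finset.mul_sum] at h2
  have h3 := mul_le_mul_of_nonneg_left h1 hM
  unfold ruleWait
  linarith

/-- Each padding index loses at most `M` against water-filling. The extra `B_U` pays for the index
shift: a delivery time sums `Y 1, …, Y J` rather than `Y 0, …, Y (J - 1)`. -/
theorem RegularPath.deliveryTime_blockRule_ge (hM : 0 ≤ M)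
    (hs : ∀ i, s (i + 1) - s i ∈ Set.Icc 0 (m * M))
    (h : RegularPath Y (ruleWait Y (blockRule M x m s)) B_L B_U M ω) (r : ℕ) :
    ∑ j ∈ Finset.range (m * r ^ 2), (Y j ω + fill M x (Y j ω)) - M * (r * m) - B_U ≤
      deliveryTime Y (ruleWait Y (blockRule M x m s)) (m * r ^ 2) ω := by
  have h1 := sum_blockRule_ge (Y := Y) (ω := ω) (x := x) hM hs (le_refl (m * r ^ 2))
  have h2 := Finset.sum_range_succ_sub_sum (fun j => Y j ω) (n := m * r ^ 2)
  have h3 := Finset.sum_range_succ' (fun j => Y j ω) (m * r ^ 2)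
  rw [deliveryTime_eq_sum]
  rw [Finset.sum_add_distrib] at h1 ⊢
  have h4 : (0 : ℝ) ≤ Y (m * r ^ 2) ω := h.pos.le.trans (h.delay_mem _).1
  have h5 := (h.delay_mem 0).2
  rw [Finset.sum_add_distrib] at h1 ⊢
  linarith

end Paths

section Policy

variable {Ω : Type*} [MeasurableSpace Ω] {P : Measure Ω} {Y : ℕ → Ω → ℝ} {M : ℝ}

/-- A policy that chooses the waiting period `Z j` as a function of the last delay `Y j`. -/
def CausalPolicy.ofRule (hYm : ∀ j, Measurable (Y j)) (hY : iIndepFun Y P) (ζ : ℕ → ℝ → ℝ)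
    (hζ : ∀ j, Measurable (ζ j)) (hmem : ∀ j y, ζ j y ∈ Set.Icc 0 M) : CausalPolicy P Y M where
  wait := ruleWait Y ζ
  measurable_wait j := (hζ j).comp (hYm j)
  wait_mem j ω := hmem j (Y j ω)
  causal j := by
    -- Delays and waits up to index `j` are functions of `Y 0, …, Y j`, so independence of disjoint
    -- families of delays suffices.
    have h := indep_iSup_of_disjoint (fun i => (hYm i).comap_le) hY.iIndep
      (S := Set.Iic j) (T := Set.Ioi j)
      (Set.disjoint_left.2 fun i hi hi' => absurd (Set.mem_Iic.1 hi) (not_le.2 hi'))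
    have hle : ∀ (S : Set ℕ), ∀ i ∈ S, Measurable[⨆ i ∈ S, MeasurableSpace.comap (Y i) inferInstance]
        (Y i) := fun S i hi =>
      Measurable.mono (comap_measurable (Y i)) (le_biSup
        (fun i => MeasurableSpace.comap (Y i) inferInstance) hi) le_rfl
    rw [IndepFun_iff_Indep]
    refine indep_of_indep_of_le_right (indep_of_indep_of_le_left h ?_) ?_
    · refine Measurable.comap_le ((@measurable_pi_iff _ _ _ (_) _ _).2 fun i => ?_)
      have hi := hle (Set.Iic j) i (Nat.lt_succ_iff.1 i.2)
      exact hi.prodMk ((hζ i).comp hi)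
    · refine Measurable.comap_le ((@measurable_pi_iff _ _ _ (_) _ _).2 fun i => ?_)
      exact hle (Set.Ioi j) (j + 1 + i) (Set.mem_Ioi.2 (by omega))

end Policy

end

end PullOrWait

namespace PullOrWait

noncomputable section

/-! ### The query average of block policies -/

variable {Ω : Type*} [MeasurableSpace Ω] {P : Measure Ω} {Y : ℕ → Ω → ℝ} {B_L B_U M x T : ℝ}
  {g : ℝ≥0 → ℝ≥0} {m : ℕ} {s : ℕ → ℝ}

/-- The shifts `s` bring the expected penalty at the queries after the padding of each block down
to the time average. -/
def GoodShifts (P : Measure Ω) (g : ℝ≥0 → ℝ≥0) (Y : ℕ → Ω → ℝ) (M x T : ℝ) (m : ℕ)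
    (s : ℕ → ℝ) : Prop :=
  ∀ i, ∫⁻ ω, ∑ j ∈ Finset.Ico (m * i ^ 2 + m) (m * (i + 1) ^ 2), ∑' k : ℕ,
      updatePenalty g Y (ruleWait Y (blockRule M x m 0)) j (k * T - s (i + 1)) ω ∂P ≤
    ENNReal.ofReal ((Finset.Ico (m * i ^ 2 + m) (m * (i + 1) ^ 2)).card *
      (meanCost P g Y M x / T))

/-- The deviation of the first `J` cycle lengths from their mean. -/
def cycleDeviation (P : Measure Ω) (Y : ℕ → Ω → ℝ) (M x : ℝ) (J : ℕ) : ℝ :=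
  ∫ ω, |J * meanCycle P Y M x - ∑ j ∈ Finset.range J, (Y j ω + fill M x (Y j ω))| ∂P

/-- No sign is assumed on `f`; `ENNReal.ofReal` cuts off its negative part, which can only increase
the right side. -/
theorem ofReal_integral_le_lintegral {f : Ω → ℝ} (hf : Integrable f P) :
    ENNReal.ofReal (∫ ω, f ω ∂P) ≤ ∫⁻ ω, ENNReal.ofReal (f ω) ∂P := by
  refine (ENNReal.ofReal_le_ofReal
    (integral_mono hf hf.pos_part fun ω => le_max_left (f ω) 0)).trans ?_
  rw [ofReal_integral_eq_lintegral_ofReal hf.pos_part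
    (Eventually.of_forall fun ω => le_max_right (f ω) 0)]
  exact lintegral_mono fun ω => by simp [ENNReal.ofReal_max]

namespace IsDelay

theorem measurable_ruleWait (h : IsDelay P Y B_L B_U) (M x : ℝ) (m : ℕ) (s : ℕ → ℝ) (j : ℕ) :
    Measurable (ruleWait Y (blockRule M x m s) j) :=
  (measurable_blockRule M x m s j).comp (h.measurable j)

variable [IsProbabilityMeasure P]

/-- The condition on block `i` concerns only the reference path and `s (i + 1)`, so the shifts can
be chosen separately. Taking `s (i + 1)` in `[i * T, (i + 1) * T)` makes them nondecreasing with
steps of at most `2 * T`, which `m` waits in `[0, M]` can realize. -/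
theorem exists_goodShifts (h : IsDelay P Y B_L B_U) (hM : 0 ≤ M) (hgc : Continuous g)
    (hgm : Monotone g) (x : ℝ) (hT : 0 < T) (hmT : 2 * T ≤ m * M) :
    ∃ s : ℕ → ℝ, s 0 = 0 ∧ (∀ i, s (i + 1) - s i ∈ Set.Icc 0 (m * M)) ∧
      GoodShifts P g Y M x T m s := by
  have hex := fun i : ℕ => exists_shift h hM hgc hgm (h.measurable_ruleWait M x m 0) (x := x)
    (Finset.Ico (m * i ^ 2 + m) (m * (i + 1) ^ 2)) (fun j hj => by
      funext ω
      rw [ruleWait, blockRule,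
        if_neg (not_isPadding_of (Finset.mem_Ico.1 hj).1 (Finset.mem_Ico.1 hj).2)])
    (i * T) hT
  choose t ht hcost using hex
  refine ⟨fun | 0 => 0 | i + 1 => t i, rfl, fun i => ?_, hcost⟩
  cases i with
  | zero =>
    have := ht 0
    simp only [Nat.cast_zero, zero_mul, zero_add] at this
    change t 0 - 0 ∈ _
    exact ⟨by linarith [this.1], by linarith [this.2]⟩
  | succ i =>
    have h1 := ht i
    have h2 := ht (i + 1)
    push_cast at h2
    change t (i + 1) - t i ∈ _
    exact ⟨by linarith [h1.2, h2.1], by linarith [h1.1, h2.2]⟩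

theorem lintegral_sum_updatePenalty_le (h : IsDelay P Y B_L B_U) (hM : 0 ≤ M) (hgc : Continuous g)
    (hgm : Monotone g) (hT : 0 < T) (hm : 0 < m) (hs0 : s 0 = 0)
    (hs : ∀ i, s (i + 1) - s i ∈ Set.Icc 0 (m * M)) (hgood : GoodShifts P g Y M x T m s)
    (n r : ℕ) :
    ∫⁻ ω, ∑ j ∈ Finset.range (m * r ^ 2), ∑ k ∈ Finset.Icc 1 n,
        updatePenalty g Y (ruleWait Y (blockRule M x m s)) j (k * T) ω ∂P ≤
      ENNReal.ofReal (r * (m * (penalty g (2 * B_U + M) * ((M + B_U) / T + 1))) +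
        (m * r ^ 2 : ℕ) * (meanCost P g Y M x / T)) := by
  set K := penalty g (2 * B_U + M) * ((M + B_U) / T + 1) with hK
  have hBU : 0 ≤ B_U := by
    obtain ⟨ω, hω⟩ := (h.mem 0).exists
    linarith [hω.1, hω.2, h.pos]
  have hK0 : 0 ≤ K := mul_nonneg (penalty_nonneg _ _) (by positivity)
  have hc0 : 0 ≤ meanCost P g Y M x / T := div_nonneg (h.meanCost_nonneg hM hgc hgm x) hT.le
  set u : ℕ → Ω → ℝ≥0∞ := fun j ω => ∑ k ∈ Finset.Icc 1 n,
    updatePenalty g Y (ruleWait Y (blockRule M x m s)) j (k * T) ω with hu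
  have hum : ∀ j, Measurable (u j) := fun j => Finset.measurable_fun_sum _ fun k _ =>
    (measurable_updatePenalty hgc h.measurable (h.measurable_ruleWait M x m s) j).comp
      measurable_prodMk_left
  have hsum : ∀ S : Finset ℕ, Measurable fun ω => ∑ j ∈ S, u j ω :=
    fun S => Finset.measurable_fun_sum _ fun j _ => hum j
  induction r with
  | zero => simp
  | succ r ih =>
    have hle1 : m * r ^ 2 ≤ m * r ^ 2 + m := Nat.le_add_right _ m
    have hle2 := padding_end_le m r
    have h1 : ∫⁻ ω, ∑ j ∈ Finset.Ico (m * r ^ 2) (m * r ^ 2 + m), u j ω ∂P ≤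
        ENNReal.ofReal (m * K) := by
      calc _ ≤ ∫⁻ _ω, ∑ _j ∈ Finset.Ico (m * r ^ 2) (m * r ^ 2 + m), ENNReal.ofReal K ∂P := by
            refine lintegral_mono_ae ?_
            filter_upwards [h.ae_regularPath fun j ω => blockRule_mem hM x hs j (Y j ω)]
              with ω hω
            refine Finset.sum_le_sum fun j _ => ?_
            exact RegularPath.sum_updatePenalty_le
              (Z := ruleWait Y (blockRule M x m s)) hω hgm hT n j
        _ = ENNReal.ofReal (m * K) := by
            rw [ENNReal.ofReal_mul (Nat.cast_nonneg m)]
            simp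
    have h2 : ∫⁻ ω, ∑ j ∈ Finset.Ico (m * r ^ 2 + m) (m * (r + 1) ^ 2), u j ω ∂P ≤
        ENNReal.ofReal (((m * (r + 1) ^ 2 : ℕ) - (m * r ^ 2 : ℕ)) *
          (meanCost P g Y M x / T)) := by
      refine le_trans (lintegral_mono fun ω => Finset.sum_le_sum fun j hj => ?_)
        ((hgood r).trans (ENNReal.ofReal_le_ofReal (mul_le_mul_of_nonneg_right ?_ hc0)))
      · simp only [hu, updatePenalty_blockRule hm hs0 (Finset.mem_Ico.1 hj).1 (Finset.mem_Ico.1 hj).2]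
        exact ENNReal.sum_le_tsum _
      -- The block is charged its full length, padding included, so that the bounds telescope to `m
      -- * r ^ 2`.
      · rw [Nat.card_Ico, Nat.cast_sub hle2]
        push_cast
        linarith [Nat.cast_nonneg (α := ℝ) m]
    simp_rw [← Finset.sum_range_add_sum_Ico _ (hle1.trans hle2),
      ← Finset.sum_Ico_consecutive _ hle1 hle2]
    rw [lintegral_add_left (hsum _), lintegral_add_left (hsum _)]
    refine (add_le_add ih (add_le_add h1 h2)).trans (le_of_eq ?_)
    have hd : (0 : ℝ) ≤ (m * (r + 1) ^ 2 : ℕ) - (m * r ^ 2 : ℕ) :=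
      sub_nonneg.2 (Nat.cast_le.2 (hle1.trans hle2))
    rw [← ENNReal.ofReal_add (by positivity) (mul_nonneg hd hc0),
      ← ENNReal.ofReal_add (by positivity) (add_nonneg (by positivity) (mul_nonneg hd hc0))]
    congr 1
    push_cast
    ring

theorem integrable_deviation (h : IsDelay P Y B_L B_U) (hM : 0 ≤ M) (x : ℝ) (J : ℕ) :
    Integrable (fun ω => |J * meanCycle P Y M x -
      ∑ j ∈ Finset.range J, (Y j ω + fill M x (Y j ω))|) P :=
  ((integrable_const _).sub (integrable_finsetSum _ fun j _ =>
    (h.integrable j).add (h.integrable_fill hM x j))).abs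

/-- The law of large numbers in `L¹` for the i.i.d. cycle lengths `Y j + fill M x (Y j)`. -/
theorem tendsto_cycleDeviation (h : IsDelay P Y B_L B_U) (hM : 0 ≤ M) (x : ℝ) :
    Tendsto (fun J : ℕ => cycleDeviation P Y M x J / J) atTop (nhds 0) := by
  have hXm : Measurable fun y : ℝ => y + fill M x y := measurable_id.add (measurable_fill M x)
  have hX0 : Integrable (fun ω => Y 0 ω + fill M x (Y 0 ω)) P :=
    (h.integrable 0).add (h.integrable_fill hM x 0)
  have hsl := strong_law_Lp (μ := P) (p := 1) le_rfl ENNReal.one_ne_top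
    (fun j ω => Y j ω + fill M x (Y j ω)) (memLp_one_iff_integrable.2 hX0)
    (fun i j hij => (h.indep.indepFun hij).comp hXm hXm)
    (fun j => (h.ident j).comp hXm)
  have ht := (ENNReal.tendsto_toReal ENNReal.zero_ne_top).comp hsl
  refine ht.congr' ?_
  filter_upwards [eventually_gt_atTop 0] with J hJ
  have hJ' : (0 : ℝ) < J := Nat.cast_pos.2 hJ
  have hsum : Measurable fun ω => ∑ i ∈ Finset.range J, (Y i ω + fill M x (Y i ω)) :=
    Finset.measurable_fun_sum _ fun j _ => hXm.comp (h.measurable j)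
  have hmeas : Measurable fun ω => (J : ℝ)⁻¹ • ∑ i ∈ Finset.range J, (Y i ω + fill M x (Y i ω)) -
      ∫ ω, (Y 0 ω + fill M x (Y 0 ω)) ∂P :=
    (hsum.const_smul (J : ℝ)⁻¹).sub_const _
  simp only [Function.comp_apply]
  rw [eLpNorm_one_eq_lintegral_enorm, ← integral_norm_eq_lintegral_enorm
    hmeas.aestronglyMeasurable, cycleDeviation, ← integral_div]
  congr 1
  funext ω
  rw [Real.norm_eq_abs, abs_sub_comm, ← abs_of_pos hJ', ← abs_div, abs_of_pos hJ', sub_div,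
    mul_div_cancel_left₀ _ hJ'.ne', smul_eq_mul, inv_mul_eq_div, meanCycle]

/-- Bound on the expected penalty at the first `n` queries under a block policy, when the first `r`
blocks are expected to cover them. -/
theorem lintegral_sum_agePenalty_le (h : IsDelay P Y B_L B_U) (hM : 0 ≤ M) (hgc : Continuous g)
    (hgm : Monotone g) (hT : 0 < T) (hm : 0 < m) (hs0 : s 0 = 0)
    (hs : ∀ i, s (i + 1) - s i ∈ Set.Icc 0 (m * M)) (hgood : GoodShifts P g Y M x T m s)
    {n r : ℕ} (hr : n * T ≤ (m * r ^ 2 : ℕ) * meanCycle P Y M x) :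
    ∫⁻ ω, ∑ k ∈ Finset.Icc 1 n,
        agePenalty g Y (ruleWait Y (blockRule M x m s)) (k * T) ω ∂P ≤
      ENNReal.ofReal (r * (m * (penalty g (2 * B_U + M) * ((M + B_U) / T + 1))) +
        (m * r ^ 2 : ℕ) * (meanCost P g Y M x / T) +
        penalty g (2 * B_U + M) *
          ((cycleDeviation P Y M x (m * r ^ 2) + (M * (r * m) + B_U)) / T + 2)) := by
  have hBU : 0 ≤ B_U := by
    obtain ⟨ω, hω⟩ := (h.mem 0).exists
    linarith [hω.1, hω.2, h.pos]
  have hG := penalty_nonneg g (2 * B_U + M)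
  have hc0 : 0 ≤ meanCost P g Y M x / T := div_nonneg (h.meanCost_nonneg hM hgc hgm x) hT.le
  set J := m * r ^ 2 with hJ
  set W := ruleWait Y (blockRule M x m s) with hW
  let dev : Ω → ℝ := fun ω =>
    |J * meanCycle P Y M x - ∑ j ∈ Finset.range J, (Y j ω + fill M x (Y j ω))|
  have hdev : Integrable dev P := h.integrable_deviation hM x J
  have hdev0 : ∀ ω, 0 ≤ dev ω := fun ω => abs_nonneg _
  have hC0 : 0 ≤ M * (r * m) + B_U := by positivity
  let F : Ω → ℝ := fun ω =>
    penalty g (2 * B_U + M) * ((dev ω + (M * (r * m) + B_U)) / T + 2)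
  have hF0 : ∀ ω, 0 ≤ F ω := fun ω => mul_nonneg hG
    (add_nonneg (div_nonneg (add_nonneg (hdev0 ω) hC0) hT.le) zero_le_two)
  have hFi : Integrable F P :=
    (((hdev.add (integrable_const _)).div_const T).add (integrable_const _)).const_mul _
  have hFint : ∫ ω, F ω ∂P = penalty g (2 * B_U + M) *
      ((cycleDeviation P Y M x J + (M * (r * m) + B_U)) / T + 2) := by
    have e1 : Integrable (fun ω => dev ω + (M * (r * m) + B_U)) P := hdev.add (integrable_const _)
    simp only [F]
    rw [integral_const_mul, integral_add (e1.div_const T) (integrable_const _), integral_div,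
      integral_add hdev (integrable_const _)]
    simp [cycleDeviation, dev]
  have hum : Measurable fun ω => ∑ j ∈ Finset.range J, ∑ k ∈ Finset.Icc 1 n,
      updatePenalty g Y W j (k * T) ω :=
    Finset.measurable_fun_sum _ fun j _ => Finset.measurable_fun_sum _ fun k _ =>
      (measurable_updatePenalty hgc h.measurable (h.measurable_ruleWait M x m s) j).comp
        measurable_prodMk_left
  calc ∫⁻ ω, ∑ k ∈ Finset.Icc 1 n, agePenalty g Y W (k * T) ω ∂P
      ≤ ∫⁻ ω, (∑ j ∈ Finset.range J, ∑ k ∈ Finset.Icc 1 n, updatePenalty g Y W j (k * T) ω +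
          ENNReal.ofReal (F ω)) ∂P := by
        refine lintegral_mono_ae ?_
        filter_upwards [h.ae_regularPath (Z := W) fun j ω => blockRule_mem hM x hs j (Y j ω)]
          with ω hω
        refine (hω.sum_agePenalty_le hgm hT n J).trans ?_
        gcongr
        have hD := hω.deliveryTime_blockRule_ge hM hs r
        refine mul_le_mul_of_nonneg_left (add_le_add_left (div_le_div_of_nonneg_right
          (max_le ?_ (add_nonneg (hdev0 ω) hC0)) hT.le) _) hG
        -- By `hr` the first `n` queries end by the mean duration of `J` cycles, so the time left
        -- uncovered is at most the deviation from this mean plus the loss in `hD`.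
        have := le_abs_self (J * meanCycle P Y M x -
          ∑ j ∈ Finset.range J, (Y j ω + fill M x (Y j ω)))
        simp only [dev]
        linarith
    _ ≤ _ := by
        rw [lintegral_add_left hum, ← ofReal_integral_eq_lintegral_ofReal hFi
          (Eventually.of_forall hF0), hFint]
        have hF0' := integral_nonneg (μ := P) (f := F) hF0
        rw [hFint] at hF0'
        rw [ENNReal.ofReal_add (p := _ + _) (by positivity) hF0']
        gcongr
        exact h.lintegral_sum_updatePenalty_le hM hgc hgm hT hm hs0 hs hgood n r

theorem queryAverage_blockRule_le (h : IsDelay P Y B_L B_U) (hM : 0 ≤ M) (hgc : Continuous g)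
    (hgm : Monotone g) (hT : 0 < T) (hm : 0 < m) (hs0 : s 0 = 0)
    (hs : ∀ i, s (i + 1) - s i ∈ Set.Icc 0 (m * M)) (hgood : GoodShifts P g Y M x T m s) :
    queryAverage P g Y (ruleWait Y (blockRule M x m s)) (fun k => (k : ℝ) * T) ≤
      ENNReal.ofReal (meanCost P g Y M x / meanCycle P Y M x) := by
  have hb := h.meanCycle_pos hM x
  set a := meanCost P g Y M x with ha
  set b := meanCycle P Y M x with hbdef
  have hm' : (0 : ℝ) < m := Nat.cast_pos.2 hm
  -- With `r ^ 2 ≈ q * n`, the first `r` blocks have mean duration `m * r ^ 2 * b ≈ n * T`. The main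
  -- term per query tends to `m * q * (a / T) = a / b`; all the others are `o(n)`.
  set q := T / (b * m) with hq
  have hq0 : 0 < q := by positivity
  let r : ℕ → ℕ := fun n => ⌈√q * √(n : ℝ)⌉₊
  have hsqrt : Tendsto (fun n : ℕ => √(n : ℝ)) atTop atTop :=
    Real.tendsto_sqrt_atTop.comp tendsto_natCast_atTop_atTop
  have hr1 : Tendsto (fun n : ℕ => (r n : ℝ) / √(n : ℝ)) atTop (nhds (√q)) :=
    (tendsto_nat_ceil_mul_div_atTop (Real.sqrt_nonneg q)).comp hsqrt
  have hr2 : Tendsto (fun n : ℕ => (r n : ℝ) ^ 2 / n) atTop (nhds q) := by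
    have := hr1.pow 2
    rw [Real.sq_sqrt hq0.le] at this
    refine this.congr fun n => ?_
    rw [div_pow, Real.sq_sqrt (Nat.cast_nonneg n)]
  have hr3 : Tendsto (fun n : ℕ => (r n : ℝ) / n) atTop (nhds 0) := by
    have := hr1.mul (tendsto_inv_atTop_zero.comp hsqrt)
    rw [mul_zero] at this
    refine this.congr fun n => ?_
    rw [Function.comp_apply, ← div_eq_mul_inv, div_div, Real.mul_self_sqrt (Nat.cast_nonneg n)]
  have hJtop : Tendsto (fun n => m * r n ^ 2) atTop atTop := by
    have h1 : Tendsto r atTop atTop :=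
      tendsto_nat_ceil_atTop.comp (hsqrt.const_mul_atTop (Real.sqrt_pos.2 hq0))
    refine tendsto_atTop_mono (fun n => ?_) h1
    calc r n ≤ r n ^ 2 := Nat.le_self_pow two_ne_zero _
      _ ≤ m * r n ^ 2 := Nat.le_mul_of_pos_left _ hm
  have hJ : Tendsto (fun n : ℕ => ((m * r n ^ 2 : ℕ) : ℝ) / n) atTop (nhds (m * q)) := by
    refine (hr2.const_mul (m : ℝ)).congr fun n => ?_
    push_cast
    ring
  have hdev : Tendsto (fun n : ℕ => cycleDeviation P Y M x (m * r n ^ 2) / n) atTop (nhds 0) := by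
    have := ((h.tendsto_cycleDeviation hM x).comp hJtop).mul hJ
    rw [zero_mul] at this
    refine this.congr' ?_
    filter_upwards [hJtop.eventually_gt_atTop 0] with n hn
    have hn' : ((m * r n ^ 2 : ℕ) : ℝ) ≠ 0 := Nat.cast_ne_zero.2 hn.ne'
    simp only [Function.comp_apply]
    field_simp
  have hinv : ∀ C : ℝ, Tendsto (fun n : ℕ => C / n) atTop (nhds 0) := tendsto_const_div_atTop_nhds_zero_nat
  have hcover : ∀ n : ℕ, n * T ≤ (m * r n ^ 2 : ℕ) * b := by
    intro n
    have h1 : √q * √(n : ℝ) ≤ r n := Nat.le_ceil _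
    have h2 : q * n ≤ (r n : ℝ) ^ 2 := by
      have := pow_le_pow_left₀ (by positivity) h1 2
      rwa [mul_pow, Real.sq_sqrt hq0.le, Real.sq_sqrt (Nat.cast_nonneg n)] at this
    have h3 : (n : ℝ) * T = (b * m) * (q * n) := by rw [hq]; field_simp
    rw [h3]
    push_cast
    nlinarith [mul_pos hb hm']
  set G := penalty g (2 * B_U + M) with hG
  set K := G * ((M + B_U) / T + 1) with hK
  let w : ℕ → ℝ := fun n => r n * (m * K) + (m * r n ^ 2 : ℕ) * (a / T) +
    G * ((cycleDeviation P Y M x (m * r n ^ 2) + (M * (r n * m) + B_U)) / T + 2)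
  have hw : Tendsto (fun n => w n / n) atTop (nhds (a / b)) := by
    have hlim := ((hr3.mul_const (m * K)).add (hJ.mul_const (a / T))).add
      ((((hdev.add (((hr3.mul_const (m : ℝ)).const_mul M).add (hinv B_U))).div_const T).add
        (hinv 2)).const_mul G)
    have hval : 0 * (m * K) + m * q * (a / T) +
        G * ((0 + (M * (0 * (m : ℝ)) + 0)) / T + 0) = a / b := by
      rw [hq]; field_simp; ring
    rw [hval] at hlim
    refine hlim.congr fun n => ?_
    simp only [w]
    ring
  unfold queryAverage
  rw [← (ENNReal.tendsto_ofReal hw).limsup_eq]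
  refine limsup_le_limsup ?_
  filter_upwards [eventually_gt_atTop 0] with n hn
  rw [ENNReal.ofReal_div_of_pos (Nat.cast_pos.2 hn), ENNReal.ofReal_natCast]
  gcongr
  exact h.lintegral_sum_agePenalty_le hM hgc hgm hT hm hs0 hs hgood (hcover n)

theorem meetsPower_blockRule (h : IsDelay P Y B_L B_U) (hM : 0 ≤ M) (hm : 0 < m)
    (hs : ∀ i, s (i + 1) - s i ∈ Set.Icc 0 (m * M)) {fmax : ℝ≥0∞}
    (hf : fmax⁻¹ ≤ ENNReal.ofReal (meanCycle P Y M x)) :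
    MeetsPower P Y (ruleWait Y (blockRule M x m s)) fmax := by
  set b := meanCycle P Y M x with hb
  -- So many blocks contain the first `n` updates, and their padding loses at most `M * (r n * m)`,
  -- of order `√n`.
  let r : ℕ → ℕ := fun n => ⌈1 * √(n : ℝ)⌉₊
  have hsqrt : Tendsto (fun n : ℕ => √(n : ℝ)) atTop atTop :=
    Real.tendsto_sqrt_atTop.comp tendsto_natCast_atTop_atTop
  have hr3 : Tendsto (fun n : ℕ => (r n : ℝ) / n) atTop (nhds 0) := by
    have := ((tendsto_nat_ceil_mul_div_atTop (zero_le_one (α := ℝ))).comp hsqrt).mul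
      (tendsto_inv_atTop_zero.comp hsqrt)
    rw [mul_zero] at this
    refine this.congr fun n => ?_
    rw [Function.comp_apply, Function.comp_apply, ← div_eq_mul_inv, div_div,
      Real.mul_self_sqrt (Nat.cast_nonneg n)]
  have hlim : Tendsto (fun n : ℕ => ENNReal.ofReal (b - M * ((r n : ℝ) / n * m))) atTop
      (nhds (ENNReal.ofReal b)) := by
    have := ((hr3.mul_const (m : ℝ)).const_mul M).const_sub b
    rw [zero_mul, mul_zero, sub_zero] at this
    exact ENNReal.tendsto_ofReal this
  refine hf.trans ?_
  rw [← hlim.liminf_eq]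
  refine liminf_le_liminf ?_
  filter_upwards [eventually_gt_atTop 0] with n hn
  have hn' : (0 : ℝ) < n := Nat.cast_pos.2 hn
  have hcover : n ≤ m * r n ^ 2 := by
    have h1 : √(n : ℝ) ≤ r n := (one_mul √(n : ℝ)).symm.le.trans (Nat.le_ceil _)
    have h2 := pow_le_pow_left₀ (Real.sqrt_nonneg _) h1 2
    rw [Real.sq_sqrt hn'.le] at h2
    have h3 : n ≤ r n ^ 2 := by exact_mod_cast h2
    exact h3.trans (Nat.le_mul_of_pos_left _ hm)
  have hXi : ∀ j, Integrable (fun ω => Y j ω + fill M x (Y j ω)) P :=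
    fun j => (h.integrable j).add (h.integrable_fill hM x j)
  have hint : ∫ ω, (∑ j ∈ Finset.range n, (Y j ω + fill M x (Y j ω)) - M * (r n * m)) ∂P =
      n * b - M * (r n * m) := by
    rw [integral_sub (integrable_finsetSum _ fun j _ => hXi j) (integrable_const _),
      integral_finsetSum _ fun j _ => hXi j]
    simp_rw [integral_add (h.integrable _) (h.integrable_fill hM x _), h.integral_eq,
      h.integral_fill_eq]
    rw [hb, h.meanCycle_eq hM]
    simp
    ring
  rw [show b - M * ((r n : ℝ) / n * m) = (n * b - M * (r n * m)) / n by field_simp,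
    ENNReal.ofReal_div_of_pos hn', ENNReal.ofReal_natCast, ← hint]
  gcongr
  refine (ofReal_integral_le_lintegral ((integrable_finsetSum _ fun j _ => hXi j).sub
    (integrable_const _))).trans (lintegral_mono fun ω => ?_)
  exact ENNReal.ofReal_le_ofReal (sum_blockRule_ge hM hs hcover)

/-- Aligned water-filling: a causal policy that meets the power constraint and whose query average
is at most the mean penalty per mean cycle of water-filling at level `x`. -/
theorem exists_policy (h : IsDelay P Y B_L B_U) (hM : 0 < M) (hgc : Continuous g)
    (hgm : Monotone g) (hT : 0 < T) {fmax : ℝ≥0∞}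
    (hf : fmax⁻¹ ≤ ENNReal.ofReal (meanCycle P Y M x)) :
    ∃ π : CausalPolicy P Y M, MeetsPower P Y π.wait fmax ∧
      queryAverage P g Y π.wait (fun k => (k : ℝ) * T) ≤
        ENNReal.ofReal (meanCost P g Y M x / meanCycle P Y M x) := by
  -- Enough padding updates for total waits of up to `2 * T`, the largest step between consecutive
  -- shifts.
  obtain ⟨m, hmge⟩ := exists_nat_ge (2 * T / M)
  have hmT : 2 * T ≤ m * M := (div_le_iff₀ hM).1 hmge
  have hm : 0 < m := by
    have : (0 : ℝ) < m := lt_of_lt_of_le (by positivity) hmge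
    exact_mod_cast this
  obtain ⟨s, hs0, hs, hgood⟩ := h.exists_goodShifts hM.le hgc hgm x hT hmT
  exact ⟨CausalPolicy.ofRule h.measurable h.indep (blockRule M x m s)
      (measurable_blockRule M x m s) (blockRule_mem hM.le x hs),
    h.meetsPower_blockRule hM.le hm hs hf,
    h.queryAverage_blockRule_le hM.le hgc hgm hT hm hs0 hs hgood⟩

end IsDelay

end

end PullOrWait

theorem theorem1 {Ω : Type*} [MeasurableSpace Ω] (P : Measure Ω) [IsProbabilityMeasure P]
    (Y : ℕ → Ω → ℝ) (hYm : ∀ j, Measurable (Y j))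
    (hYindep : iIndepFun Y P) (hYident : ∀ j, IdentDistrib (Y j) (Y 0) P P)
    (B_L B_U : ℝ) (hB_L : 0 < B_L) (hYmem : ∀ j, ∀ᵐ ω ∂P, Y j ω ∈ Set.Icc B_L B_U)
    (M : ℝ) (hM : 0 < M)
    (g : ℝ≥0 → ℝ≥0) (hgc : Continuous g) (hgm : Monotone g)
    (fmax : ℝ≥0∞) (T : ℝ) (hT : 0 < T) :
    PullOrWait.powOpt P g Y M fmax (fun k => (k : ℝ) * T) ≤
      PullOrWait.uowOpt P g Y M fmax := by
  have h : PullOrWait.IsDelay P Y B_L B_U := ⟨hYm, hYindep, hYident, hB_L, hYmem⟩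
  refine le_iInf₂ fun π hπ => ?_
  obtain ⟨x, hxf, hx⟩ :=
    PullOrWait.CausalPolicy.exists_level_le_timeAverage h hM.le hgc hgm π hπ
  obtain ⟨π', hπ', hle⟩ := h.exists_policy hM hgc hgm hT hxf
  exact (iInf₂_le π' hπ').trans (hle.trans hx)
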